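/- Let $n\ge 2$, and let $f:\mathbb R^n\to[0,\infty)$ and $h:\mathbb R^n\times\mathbb S^{n-1}\to[0,\infty)$ be lower semicontinuous and locally integrable. For a Borel set $E\subseteq\mathbb R^n$ of finite perimeter put $$|E|_f=\int_E f(x)\,dx,\qquad P_h(E)=\int_{\partial^*E}h(x,\nu_E(x))\,d\mathcal H^{n-1}(x),$$ where $\partial^*E$ is the reduced boundary of $E$ and $\nu_E$ its outer unit normal. Let $\omega_n$ be the volume of the unit ball of $\mathbb R^n$. When $0<|E|_f<\infty$ and $P_h(E)<\infty$, the $(f,h)$-mean density of $E$ is the number $\rho\ge 0$ with $P_h(E)=n(\omega_n\rho)^{1/n}|E|_f^{(n-1)/n}$. Put $h^+(x)=\sup_{\nu\in\mathbb S^{n-1}}h(x,\nu)$, $\tilde f=|f-1|$, $\tilde h=|h^+-1|$. Suppose that $f$ and $h^+$ converge from below to $1$, that is, each of them tends to $1$ as $|x|\to\infty$ and is at most $1$ outside some ball, and that $$\inf\{C\ge 0:\ \tilde f(x)\le C\,\tilde h(x)\ \text{for all sufficiently large } |x|\}<\frac{n}{n-1}\qquad(\inf\emptyset=+\infty).$$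 Then for every $m>0$ and every $R>0$ there is a Borel set $F$ of finite perimeter, contained in $\{|x|>R\}$, with $|F|_f=m$ and with $(f,h)$-mean density at most $1$; equivalently, $$P_h(F)\le n\,\omega_n^{1/n}\,m^{(n-1)/n}.$$ If moreover there is no ball outside which $h(x,\nu)=1$ for almost every $(x,\nu)$ (with respect to the product of Lebesgue measure on $\mathbb R^n$ and surface measure on $\mathbb S^{n-1}$), then $F$ can be chosen with $(f,h)$-mean density strictly less than $1$. -/

import Mathlib

open MeasureTheory Filter Topology Set Metric
open scoped NNReal ENNReal

namespace DoubleDensity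

noncomputable section

/-- Euclidean space `ℝⁿ`. -/
abbrev Space (n : ℕ) : Type := EuclideanSpace ℝ (Fin n)

/-- The unit sphere `𝕊ⁿ⁻¹` of directions. -/
abbrev Dir (n : ℕ) : Type := sphere (0 : Space n) 1

/-- `ω_n`, the Lebesgue measure of the unit ball of `ℝⁿ`. -/
def omega (n : ℕ) : ℝ := (volume : Measure (Space n)).real (ball 0 1)

/-- Lebesgue measure on `ℝⁿ` times the surface measure of `𝕊ⁿ⁻¹`. -/
def spaceDirMeasure (n : ℕ) : Measure (Space n × Dir n) :=
  (volume : Measure (Space n)).prod (volume : Measure (Space n)).toSphere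

/-- A double density on `ℝⁿ`: two lower semicontinuous, locally summable nonnegative functions
`f` on `ℝⁿ` and `h` on `ℝⁿ × 𝕊ⁿ⁻¹`. -/
structure IsDoubleDensity {n : ℕ} (f : Space n → ℝ≥0) (h : Space n × Dir n → ℝ≥0) : Prop where
  lsc_f : LowerSemicontinuous f
  lsc_h : LowerSemicontinuous h
  locallyIntegrable_f : LocallyIntegrable (fun x => (f x : ℝ)) volume
  locallyIntegrable_h : LocallyIntegrable (fun p => (h p : ℝ)) (spaceDirMeasure n)

/-- `h⁺(x) = sup_ν h(x, ν)`, as an extended nonnegative number. -/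
def hPlus {n : ℕ} (h : Space n × Dir n → ℝ≥0) (x : Space n) : ℝ≥0∞ :=
  ⨆ ν : Dir n, (h (x, ν) : ℝ≥0∞)

/-- `σ` converges from below to `l`: `σ(x) → l` as `|x| → ∞`, and `σ ≤ l` outside some ball. -/
def ConvergesFromBelow {n : ℕ} (σ : Space n → ℝ≥0∞) (l : ℝ≥0∞) : Prop :=
  Tendsto σ (Bornology.cobounded (Space n)) (𝓝 l) ∧ ∃ M : ℝ, ∀ x, M < ‖x‖ → σ x ≤ l

/-- `f̃(x) = |f(x) - 1|`. -/
def fTilde {n : ℕ} (f : Space n → ℝ≥0) (x : Space n) : ℝ := |(f x : ℝ) - 1|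

/-- `h̃(x) = |h⁺(x) - 1|`. It is used only near infinity for an `h⁺` that tends to `1`, hence
at points where `h⁺(x)` is finite. -/
def hTilde {n : ℕ} (h : Space n × Dir n → ℝ≥0) (x : Space n) : ℝ := |(hPlus h x).toReal - 1|

/-- `inf {C ≥ 0 : f̃(x) ≤ C h̃(x) for |x| ≫ 1}`, in the extended reals (so `+∞` when there is
no such `C`). -/
def compareConst {n : ℕ} (f : Space n → ℝ≥0) (h : Space n × Dir n → ℝ≥0) : EReal :=
  ⨅ C ∈ {C : ℝ | 0 ≤ C ∧ ∃ M : ℝ, ∀ x : Space n, M < ‖x‖ → fTilde f x ≤ C * hTilde h x},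
    (C : EReal)

/-- The divergence of a vector field on `ℝⁿ`. -/
def divergence {n : ℕ} (φ : Space n → Space n) (x : Space n) : ℝ :=
  ∑ i : Fin n, (fderiv ℝ φ x (EuclideanSpace.single i 1)) i

/-- The distributional gradient of the indicator of `A`, in polar form: it equals `-σ μ`, where
`μ` is a positive Radon measure (the total variation `|Dχ_A|`) and `σ` is a unit vector field
(the measure-theoretic outer normal), so that `∫_A div φ dx = ∫ ⟨φ, σ⟩ dμ` for every compactly
supported `C¹` vector field. The measure `μ` is determined by `A`, and so is `σ`, `μ`-almost
everywhere. -/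
structure IsGaussGreen {n : ℕ} (A : Set (Space n)) (μ : Measure (Space n))
    (σ : Space n → Space n) : Prop where
  locallyFinite : IsLocallyFiniteMeasure μ
  measurable : Measurable σ
  norm_eq_one : ∀ᵐ x ∂μ, ‖σ x‖ = 1
  integral_divergence : ∀ φ : Space n → Space n, ContDiff ℝ 1 φ → HasCompactSupport φ →
    ∫ x in A, divergence φ x = ∫ x, inner ℝ (φ x) (σ x) ∂μ

/-- `A` has finite perimeter: the distributional gradient of its indicator is a finite vector
measure. -/
def HasFinitePerimeter {n : ℕ} (A : Set (Space n)) : Prop :=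
  ∃ μ σ, IsGaussGreen A μ σ ∧ IsFiniteMeasure μ

/-- `x` is a point of the reduced boundary of `A`, with outer normal `ν`: `x` lies in the support
of `|Dχ_A|`, and the mean over `B_r(x)`, with respect to `|Dχ_A|`, of the outer normal field tends
to the unit vector `ν` as `r ↓ 0`. -/
def IsOuterNormalAt {n : ℕ} (A : Set (Space n)) (x : Space n) (ν : Dir n) : Prop :=
  ∃ μ σ, IsGaussGreen A μ σ ∧ (∀ r : ℝ, 0 < r → 0 < μ (ball x r)) ∧
    Tendsto (fun r : ℝ => ⨍ y in ball x r, σ y ∂μ) (𝓝[>] 0) (𝓝 (ν : Space n))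

/-- The reduced boundary `∂*A`. -/
def reducedBoundary {n : ℕ} (A : Set (Space n)) : Set (Space n) :=
  {x | ∃ ν : Dir n, IsOuterNormalAt A x ν}

open Classical in
/-- The function `x ↦ h(x, ν_A(x))`, where `ν_A` is the outer normal; it matters only on the
reduced boundary. -/
def atOuterNormal {n : ℕ} (h : Space n × Dir n → ℝ≥0) (A : Set (Space n)) (x : Space n) : ℝ≥0∞ :=
  if hx : ∃ ν : Dir n, IsOuterNormalAt A x ν then (h (x, hx.choose) : ℝ≥0∞) else 0

/-- The weighted volume `|A|_f = ∫_A f(x) dx`. -/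
def weightedVolume {n : ℕ} (f : Space n → ℝ≥0) (A : Set (Space n)) : ℝ≥0∞ :=
  ∫⁻ x in A, (f x : ℝ≥0∞)

/-- The weighted perimeter `P_h(A) = ∫_{∂*A} h(x, ν_A(x)) dℋⁿ⁻¹(x)` of a set `A` of finite
perimeter. Here `μHE[n - 1]` is the Hausdorff measure with the geometric normalization, which
agrees with Lebesgue measure on `(n-1)`-dimensional Euclidean space. -/
def weightedPerimeter {n : ℕ} (h : Space n × Dir n → ℝ≥0) (A : Set (Space n)) : ℝ≥0∞ :=
  ∫⁻ x in reducedBoundary A, atOuterNormal h A x ∂(μHE[n - 1])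

/-- The Borel set `F` has finite perimeter and `(f,h)`-mean density `ρ`:
`P_h(F) = n (ω_n ρ)^{1/n} |F|_f^{(n-1)/n}`. -/
structure IsMeanDensity {n : ℕ} (f : Space n → ℝ≥0) (h : Space n × Dir n → ℝ≥0)
    (F : Set (Space n)) (ρ : ℝ≥0) : Prop where
  measurableSet : MeasurableSet F
  finitePerimeter : HasFinitePerimeter F
  perimeter_eq : weightedPerimeter h F =
    ENNReal.ofReal (n * (omega n * ρ) ^ (1 / (n : ℝ))) *
      weightedVolume f F ^ (((n : ℝ) - 1) / n)

end

end DoubleDensity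

namespace DoubleDensity

open scoped Pointwise

variable {n : ℕ}

/-! The set sought can always be a ball. Let `r₀` be the radius with `ω_n r₀ⁿ = m`. As `f` tends to
1 from below, each far centre `c` carries a ball of weighted volume exactly `m`; its radius `r c` is
at least `r₀`, close to it, and Lipschitz in `c` with small constant (`exists_radius`). Suppose that
each of these balls has perimeter at least the Euclidean value `n ω_n r₀ⁿ⁻¹`. The excess of `r c`
over `r₀` is governed by the integral of `1 - f ≤ C (1 - h⁺)` over the ball, so the integral of `1 -
h` over the directions of the sphere is at most `(n - 1) C / r₀ⁿ` times the integral of `1 - h⁺`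
over the ball (`lintegral_sphere_le_of_le_weightedPerimeter`).

This fails on average over `c`. With a constant radius and no weight, Tonelli shows that the
averaged ball integral of a function is `r₀ⁿ / n` times its averaged sphere integral. As `1 - h⁺ ≤ 1
- h`, the averaged sphere integral `L` would satisfy `L ≤ ((n - 1) C / n) L` with a factor below 1;
this is where the threshold `n / (n - 1)` enters. Finiteness of `L` then forces `L = 0`.

Two things must be repaired. The average needs a weight that is integrable and vanishes where the
inequality is not known: `weight` is the convex function `max (‖c‖ - R) 0` times a slowly varying
decaying factor. Convexity along the segment joining the two centres whose spheres pass through a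
point in opposite directions bounds ball averages by sphere averages (`IsRadiusField.weight_le`).
The radius also varies, but `c ↦ c + r c • v` is bi-Lipschitz and costs a factor near 1. The
conclusion (`IsRadiusField.ae_eq_zero_of_forall_le`) is that `h = 1` almost everywhere near
infinity. In that case `f = 1` almost everywhere there as well, and any far ball of radius `r₀`
gives the non-strict bound.

The rest identifies the perimeter of a ball: the divergence theorem, uniqueness of the polar form of
the gradient, and an upper bound for the Hausdorff measure on the sphere. Only upper bounds on the
perimeter are needed. -/

theorem norm_dir (θ : Dir n) : ‖(θ : Space n)‖ = 1 := by simp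

/-! ### Hausdorff measure against surface measure on the unit sphere. -/

/-- Radial projection onto the unit sphere does not increase distances outside the open unit ball.
After squaring, this is Cauchy–Schwarz together with `2‖x‖‖y‖ ≤ ‖x‖² + ‖y‖²`. -/
theorem dist_le_of_one_le_norm {E : Type*} [NormedAddCommGroup E] [InnerProductSpace ℝ E]
    {x y : E} (hx : 1 ≤ ‖x‖) (hy : 1 ≤ ‖y‖) :
    ‖(‖x‖)⁻¹ • x - (‖y‖)⁻¹ • y‖ ≤ ‖x - y‖ := by
  have hx0 : 0 < ‖x‖ := by linarith
  have hy0 : 0 < ‖y‖ := by linarith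
  refine le_of_sq_le_sq ?_ (norm_nonneg _)
  rw [@norm_sub_sq_real, @norm_sub_sq_real, norm_smul, norm_smul, inner_smul_left,
    inner_smul_right]
  simp only [norm_inv, norm_norm, conj_trivial]
  rw [inv_mul_cancel₀ hx0.ne', inv_mul_cancel₀ hy0.ne']
  have hc : inner ℝ x y ≤ ‖x‖ * ‖y‖ := real_inner_le_norm x y
  obtain ⟨t, ht⟩ : ∃ t, t = inner ℝ x y := ⟨_, rfl⟩
  rw [← ht] at hc ⊢
  have hxy : 1 ≤ ‖x‖ * ‖y‖ := one_le_mul_of_one_le_of_one_le hx hy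
  have key : t * (1 - (‖x‖ * ‖y‖)⁻¹) ≤ ‖x‖ * ‖y‖ - 1 := by
    have h1 : 0 ≤ 1 - (‖x‖ * ‖y‖)⁻¹ := by
      have := inv_le_one_of_one_le₀ hxy
      linarith
    calc t * (1 - (‖x‖ * ‖y‖)⁻¹) ≤ (‖x‖ * ‖y‖) * (1 - (‖x‖ * ‖y‖)⁻¹) := by gcongr
      _ = _ := by field_simp
  have h2 : ‖x‖⁻¹ * (‖y‖⁻¹ * t) = t * (‖x‖ * ‖y‖)⁻¹ := by rw [mul_inv]; ring
  rw [h2]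
  nlinarith [sq_nonneg (‖x‖ - ‖y‖)]

theorem euclideanHausdorffMeasure_image_le {X Y : Type*} [MetricSpace X] [MeasurableSpace X]
    [BorelSpace X] [MetricSpace Y] [MeasurableSpace Y] [BorelSpace Y] {f : X → Y} {s : Set X}
    {K : ℝ≥0} (d : ℕ) (hf : LipschitzOnWith K f s) :
    (μHE[d] : Measure Y) (f '' s) ≤ (K : ℝ≥0∞) ^ d * (μHE[d] : Measure X) s := by
  rw [Measure.euclideanHausdorffMeasure_def, Measure.euclideanHausdorffMeasure_def,
    Measure.smul_apply, Measure.smul_apply, mul_smul_comm]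
  have := hf.hausdorffMeasure_image_le (d := d) (by positivity)
  gcongr
  simpa using this

/-- The part below height `a` of the open cone over a set of directions. -/
def lowCone (e : Space n) (a : ℝ) (A : Set (Dir n)) : Set (Space n) :=
  {x | (0 < inner ℝ x e ∧ inner ℝ x e < a) ∧ (‖x‖)⁻¹ • x ∈ (Subtype.val '' A : Set (Space n))}

theorem measurableSet_lowCone (e : Space n) (a : ℝ) {A : Set (Dir n)} (hA : MeasurableSet A) :
    MeasurableSet (lowCone e a A) := by
  have h1 : MeasurableSet (Subtype.val '' A : Set (Space n)) :=
    (MeasurableEmbedding.subtype_coe isClosed_sphere.measurableSet).measurableSet_image.2 hA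
  have h2 : Measurable fun x : Space n => (‖x‖)⁻¹ • x := by fun_prop
  have h3 : Measurable fun x : Space n => (inner ℝ x e : ℝ) := by fun_prop
  exact ((measurableSet_lt measurable_const h3).inter (measurableSet_lt h3 measurable_const)).inter
    (h2 h1)

/-- Project the cap centrally onto the hyperplane at height 1. The image `B` has at least the
Hausdorff measure of `A`, because radial projection takes it back without increasing distances. The
slice at height `s` of the cone over `A` contains `s • B`, so the part below height `a` has volume
at least `aⁿ / n` times the measure of `B`. That part lies in the unit cone over `A`, whose volume
defines the surface measure. -/
theorem hausdorff_le_toSphere_of_inner_gt (hn : 1 ≤ n) {e : Space n} (he : ‖e‖ = 1) {a : ℝ}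
    (ha : 0 < a) {A : Set (Dir n)} (hA : MeasurableSet A)
    (h : ∀ θ ∈ A, a < inner ℝ (θ : Space n) e) :
    ENNReal.ofReal (a ^ n) * (μHE[n - 1] : Measure (Space n)) (Subtype.val '' A) ≤
      (volume : Measure (Space n)).toSphere A := by
  set B : Set (Space n) := (fun θ : Dir n => (inner ℝ (θ : Space n) e : ℝ)⁻¹ • (θ : Space n)) '' A
    with hB
  have hnormB : ∀ θ ∈ A, 1 ≤ ‖(inner ℝ (θ : Space n) e : ℝ)⁻¹ • (θ : Space n)‖ := by
    intro θ hθ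
    have h0 := ha.trans (h θ hθ)
    have h1 : inner ℝ (θ : Space n) e ≤ 1 := by
      simpa [he] using real_inner_le_norm (θ : Space n) e
    rw [norm_smul, norm_dir, mul_one, norm_inv, Real.norm_of_nonneg h0.le]
    exact (one_le_inv₀ h0).2 h1
  have hAB : (μHE[n - 1] : Measure (Space n)) (Subtype.val '' A) ≤ μHE[n - 1] B := by
    have hlip : LipschitzOnWith 1 (fun x : Space n => (‖x‖)⁻¹ • x) B := by
      refine LipschitzOnWith.of_dist_le_mul ?_
      rintro _ ⟨θ, hθ, rfl⟩ _ ⟨η, hη, rfl⟩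
      rw [NNReal.coe_one, one_mul, dist_eq_norm, dist_eq_norm]
      exact dist_le_of_one_le_norm (hnormB θ hθ) (hnormB η hη)
    have := euclideanHausdorffMeasure_image_le (n - 1) hlip
    rw [ENNReal.coe_one, one_pow, one_mul] at this
    refine le_trans (measure_mono ?_) this
    rintro _ ⟨θ, hθ, rfl⟩
    refine ⟨_, ⟨θ, hθ, rfl⟩, ?_⟩
    have h0 := ha.trans (h θ hθ)
    simp only [norm_smul, norm_dir, mul_one, norm_inv, Real.norm_of_nonneg h0.le, inv_inv,
      smul_smul]
    rw [mul_inv_cancel₀ h0.ne', one_smul]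
  have hsub : lowCone e a A ⊆ (Ioo (0 : ℝ) 1 • (Subtype.val '' A : Set (Space n))) := by
    rintro x ⟨⟨hx0, hxa⟩, θ, hθ, hθx⟩
    have hxne : x ≠ 0 := by rintro rfl; simp at hx0
    have hxn : 0 < ‖x‖ := norm_pos_iff.2 hxne
    have hx : x = ‖x‖ • (θ : Space n) := by
      rw [hθx, smul_smul, mul_inv_cancel₀ hxn.ne', one_smul]
    refine ⟨‖x‖, ⟨hxn, ?_⟩, θ, ⟨θ, hθ, rfl⟩, hx.symm⟩
    have h1 := h θ hθ
    have h2 : inner ℝ x e = ‖x‖ * inner ℝ (θ : Space n) e := by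
      conv_lhs => rw [hx]
      rw [inner_smul_left]; simp
    rw [h2] at hxa
    by_contra hcon
    push Not at hcon
    nlinarith
  have hslice : ∀ s ∈ Ioo (0 : ℝ) a, ENNReal.ofReal (s ^ (n - 1)) * μHE[n - 1] B ≤
      μHE[n - 1] (lowCone e a A ∩
        (AffineSubspace.mk' (s • e +ᵥ (0 : Space n)) (Submodule.span ℝ {e})ᗮ :
          Set (Space n))) := by
    intro s hs
    have h1 := Measure.euclideanHausdorffMeasure_smul₀ (n - 1) hs.1.ne' B
    have h2 : ENNReal.ofReal (s ^ (n - 1)) * μHE[n - 1] B = μHE[n - 1] (s • B) := by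
      rw [h1, ENNReal.smul_def, smul_eq_mul]
      congr 1
      rw [ENNReal.coe_pow, ENNReal.ofReal_pow hs.1.le]
      congr 1
      rw [← enorm_eq_nnnorm, Real.enorm_of_nonneg hs.1.le]
    rw [h2]
    refine measure_mono ?_
    rintro _ ⟨_, ⟨θ, hθ, rfl⟩, rfl⟩
    have h0 := ha.trans (h θ hθ)
    have hpos : 0 < s * (inner ℝ (θ : Space n) e)⁻¹ := mul_pos hs.1 (inv_pos.2 h0)
    have hin : inner ℝ (s • (inner ℝ (θ : Space n) e : ℝ)⁻¹ • (θ : Space n)) e = s := by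
      rw [smul_smul, inner_smul_left]
      simp only [conj_trivial]
      field_simp
    refine ⟨⟨?_, θ, hθ, ?_⟩, ?_⟩
    · show 0 < inner ℝ (s • (inner ℝ (θ : Space n) e : ℝ)⁻¹ • (θ : Space n)) e ∧
        inner ℝ (s • (inner ℝ (θ : Space n) e : ℝ)⁻¹ • (θ : Space n)) e < a
      rw [hin]; exact hs
    · simp only [smul_smul, norm_smul, norm_dir, mul_one, Real.norm_of_nonneg hpos.le]
      rw [inv_mul_cancel₀ hpos.ne', one_smul]
    · simp only [SetLike.mem_coe, AffineSubspace.mem_mk']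
      rw [Submodule.mem_orthogonal_singleton_iff_inner_left]
      have : inner ℝ e e = 1 := by rw [real_inner_self_eq_norm_sq, he]; norm_num
      simp only [vadd_eq_add, add_zero, vsub_eq_sub, inner_sub_left]
      rw [real_inner_smul_left e e s, this, hin, mul_one, sub_self]
  have hvol : ENNReal.ofReal (a ^ n / n) * μHE[n - 1] B ≤ volume (lowCone e a A) := by
    have hfr : Module.finrank ℝ (Space n) = n := by simp
    have key := EuclideanGeometry.euclideanHausdorffMeasure_eq_lintegral (0 : Space n)
      (v := e) (by rintro rfl; simp at he) (measurableSet_lowCone e a hA)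
    rw [InnerProductSpace.euclideanHausdorffMeasure_eq_volume, hfr] at key
    have hen : ‖e‖ₑ = 1 := by rw [← ofReal_norm, he]; simp
    rw [key, hen, one_mul]
    calc ENNReal.ofReal (a ^ n / n) * μHE[n - 1] B
        = ∫⁻ s in Ioo (0 : ℝ) a, ENNReal.ofReal (s ^ (n - 1)) * μHE[n - 1] B := by
          rw [lintegral_mul_const _ (by fun_prop)]
          congr 1
          rw [Measure.restrict_congr_set Ioo_ae_eq_Ioc, ← ofReal_integral_eq_lintegral_ofReal,
            ← intervalIntegral.integral_of_le ha.le]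
          · simp only [integral_pow]
            rw [Nat.sub_add_cancel hn, Nat.cast_sub hn]
            simp [zero_pow (by omega : n ≠ 0)]
          · exact (intervalIntegral.intervalIntegrable_pow _).1
          · filter_upwards [ae_restrict_mem measurableSet_Ioc] with y hy
            exact pow_nonneg hy.1.le _
      _ ≤ ∫⁻ s in Ioo (0 : ℝ) a, μHE[n - 1] (lowCone e a A ∩
        (AffineSubspace.mk' (s • e +ᵥ (0 : Space n)) (Submodule.span ℝ {e})ᗮ :
          Set (Space n))) := setLIntegral_mono' measurableSet_Ioo hslice
      _ ≤ _ := setLIntegral_le_lintegral _ _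
  rw [Measure.toSphere_apply' _ hA]
  simp only [finrank_euclideanSpace, Fintype.card_fin]
  have hn0 : (n : ℝ) ≠ 0 := by positivity
  calc ENNReal.ofReal (a ^ n) * (μHE[n - 1] : Measure (Space n)) (Subtype.val '' A)
      = n * (ENNReal.ofReal (a ^ n / n) *
        (μHE[n - 1] : Measure (Space n)) (Subtype.val '' A)) := by
        rw [← mul_assoc, ← ENNReal.ofReal_natCast, ← ENNReal.ofReal_mul (by positivity)]
        congr 2
        field_simp
    _ ≤ n * volume (Ioo (0 : ℝ) 1 • (Subtype.val '' A : Set (Space n))) := by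
        gcongr
        exact ((mul_le_mul_right hAB _).trans hvol).trans (measure_mono hsub)

/-- On the unit sphere, the Hausdorff measure is at most the surface measure. -/
theorem hausdorff_le_toSphere (hn : 1 ≤ n) {A : Set (Dir n)} (hA : MeasurableSet A) :
    (μHE[n - 1] : Measure (Space n)) (Subtype.val '' A) ≤
      (volume : Measure (Space n)).toSphere A := by
  rcases A.eq_empty_or_nonempty with rfl | ⟨θ₀, -⟩
  · simp
  have : Nonempty (Dir n) := ⟨θ₀⟩
  -- Cut the sphere into countably many disjoint pieces, each in a small cap around a direction of a
  -- dense sequence; the loss `aⁿ` disappears as `a` tends to 1.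
  have key : ∀ a ∈ Ioo (0 : ℝ) 1,
      ENNReal.ofReal (a ^ n) * (μHE[n - 1] : Measure (Space n)) (Subtype.val '' A) ≤
      (volume : Measure (Space n)).toSphere A := by
    intro a ha
    set e := TopologicalSpace.denseSeq (Dir n)
    set U : ℕ → Set (Dir n) := fun k => {θ | a < inner ℝ (θ : Space n) (e k : Space n)} with hU
    have hUo : ∀ k, IsOpen (U k) := fun k => isOpen_lt (by fun_prop) (by fun_prop)
    have hcov : ⋃ k, U k = univ := by
      refine eq_univ_of_forall fun θ => ?_
      have hV : IsOpen {η : Dir n | a < inner ℝ (θ : Space n) (η : Space n)} :=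
        isOpen_lt (by fun_prop) (by fun_prop)
      obtain ⟨η, hη, k, rfl⟩ := (TopologicalSpace.denseRange_denseSeq (Dir n)).inter_open_nonempty
        _ hV ⟨θ, by
          show a < inner ℝ (θ : Space n) (θ : Space n)
          rw [real_inner_self_eq_norm_sq, norm_dir]; simpa using ha.2⟩
      exact mem_iUnion.2 ⟨k, hη⟩
    have hD : ∀ k, MeasurableSet (A ∩ disjointed U k) := fun k =>
      hA.inter (MeasurableSet.disjointed (fun k => (hUo k).measurableSet) k)
    have hAU : A = ⋃ k, A ∩ disjointed U k := by
      rw [← inter_iUnion, iUnion_disjointed, hcov, inter_univ]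
    calc ENNReal.ofReal (a ^ n) * (μHE[n - 1] : Measure (Space n)) (Subtype.val '' A)
        ≤ ENNReal.ofReal (a ^ n) *
          ∑' k, (μHE[n - 1] : Measure (Space n)) (Subtype.val '' (A ∩ disjointed U k)) := by
          gcongr
          conv_lhs => rw [hAU, image_iUnion]
          exact measure_iUnion_le _
      _ ≤ ∑' k, (volume : Measure (Space n)).toSphere (A ∩ disjointed U k) := by
          rw [← ENNReal.tsum_mul_left]
          refine ENNReal.tsum_le_tsum fun k => ?_
          exact hausdorff_le_toSphere_of_inner_gt hn (norm_dir (e k)) ha.1 (hD k)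
            fun θ hθ => disjointed_subset U k hθ.2
      _ = (volume : Measure (Space n)).toSphere A := by
          conv_rhs => rw [hAU]
          refine (measure_iUnion ?_ hD).symm
          intro i j hij
          exact ((disjoint_disjointed U) hij).mono inter_subset_right inter_subset_right
  have hlim : Tendsto (fun a : ℝ => ENNReal.ofReal (a ^ n) *
      (μHE[n - 1] : Measure (Space n)) (Subtype.val '' A)) (𝓝[<] 1)
      (𝓝 (ENNReal.ofReal ((1 : ℝ) ^ n) *
        (μHE[n - 1] : Measure (Space n)) (Subtype.val '' A))) := by
    refine ENNReal.Tendsto.mul_const ?_ (Or.inl (by simp))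
    refine (ENNReal.continuous_ofReal.comp (continuous_pow n)).continuousAt.tendsto.mono_left
      nhdsWithin_le_nhds
  rw [one_pow, ENNReal.ofReal_one, one_mul] at hlim
  refine le_of_tendsto hlim ?_
  filter_upwards [Ioo_mem_nhdsLT (zero_lt_one' ℝ)] with a ha using key a ha

/-! ### Uniqueness of the polar form and of the outer normal. -/

theorem IsGaussGreen.locallyIntegrable {A : Set (Space n)} {μ : Measure (Space n)}
    {σ : Space n → Space n} (h : IsGaussGreen A μ σ) : LocallyIntegrable σ μ := by
  have := h.locallyFinite
  refine (locallyIntegrable_const (1 : ℝ)).mono h.measurable.aestronglyMeasurable ?_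
  filter_upwards [h.norm_eq_one] with x hx
  simp [hx]

theorem IsGaussGreen.integral_smul_eq {A : Set (Space n)} {μ μ' : Measure (Space n)}
    {σ σ' : Space n → Space n} (h : IsGaussGreen A μ σ) (h' : IsGaussGreen A μ' σ')
    {ψ : Space n → ℝ} (hψ : ContDiff ℝ 1 ψ) (hψc : HasCompactSupport ψ) :
    ∫ x, ψ x • σ x ∂μ = ∫ x, ψ x • σ' x ∂μ' := by
  have hi := h.locallyIntegrable.integrable_smul_left_of_hasCompactSupport hψ.continuous hψc
  have hi' := h'.locallyIntegrable.integrable_smul_left_of_hasCompactSupport hψ.continuous hψc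
  refine ext_inner_left ℝ fun e => ?_
  rw [← integral_inner hi, ← integral_inner hi']
  have hc : ContDiff ℝ 1 fun x => ψ x • e := hψ.smul contDiff_const
  have hs : HasCompactSupport fun x => ψ x • e := hψc.smul_right
  have e1 := h.integral_divergence _ hc hs
  have e2 := h'.integral_divergence _ hc hs
  simp only [real_inner_smul_left] at e1 e2
  simp only [real_inner_smul_right]
  rw [← e1, e2]

/-- The polar form of the distributional gradient is unique. -/
theorem IsGaussGreen.unique {A : Set (Space n)} {μ μ' : Measure (Space n)}
    {σ σ' : Space n → Space n} (h : IsGaussGreen A μ σ) (h' : IsGaussGreen A μ' σ') :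
    μ = μ' ∧ σ =ᵐ[μ] σ' := by
  have := h.locallyFinite
  have := h'.locallyFinite
  -- A common reference measure: both vector measures become densities with respect to `κ`, which
  -- test functions identify almost everywhere. Taking norms separates the positive measure from the
  -- unit field.
  set κ := μ + μ' with hκ
  have hloc : IsLocallyFiniteMeasure κ := by
    refine ⟨fun x => ?_⟩
    obtain ⟨U, hU, hU'⟩ := μ.finiteAt_nhds x
    obtain ⟨V, hV, hV'⟩ := μ'.finiteAt_nhds x
    refine ⟨U ∩ V, inter_mem hU hV, ?_⟩
    rw [hκ, Measure.add_apply]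
    exact ENNReal.add_lt_top.2 ⟨(measure_mono inter_subset_left).trans_lt hU',
      (measure_mono inter_subset_right).trans_lt hV'⟩
  have hac : μ ≪ κ := Measure.absolutelyContinuous_of_le (Measure.le_add_right le_rfl)
  have hac' : μ' ≪ κ := Measure.absolutelyContinuous_of_le (Measure.le_add_left le_rfl)
  have hd : κ.withDensity (μ.rnDeriv κ) = μ := Measure.withDensity_rnDeriv_eq _ _ hac
  have hd' : κ.withDensity (μ'.rnDeriv κ) = μ' := Measure.withDensity_rnDeriv_eq _ _ hac'
  have aux : ∀ (ν : Measure (Space n)) (τ : Space n → Space n), IsGaussGreen A ν τ → ν ≪ κ →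
      LocallyIntegrable (fun x => (ν.rnDeriv κ x).toReal • τ x) κ := by
    intro ν τ hg hν x
    have := hg.locallyFinite
    obtain ⟨U, hU, hint⟩ := hg.locallyIntegrable x
    obtain ⟨V, hVU, hVo, hxV⟩ := _root_.mem_nhds_iff.1 hU
    refine ⟨V, hVo.mem_nhds hxV, ?_⟩
    have h1 : Integrable (V.indicator τ) ν :=
      (integrable_indicator_iff hVo.measurableSet).2 (hint.mono_set hVU)
    have h2 := (integrable_rnDeriv_smul_iff hν).2 h1
    rw [← integrable_indicator_iff hVo.measurableSet]
    refine h2.congr (Eventually.of_forall fun y => ?_)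
    by_cases hy : y ∈ V <;> simp [hy]
  have hae : ∀ᵐ x ∂κ, (μ.rnDeriv κ x).toReal • σ x = (μ'.rnDeriv κ x).toReal • σ' x := by
    refine ae_eq_of_integral_contDiff_smul_eq (aux μ σ h hac) (aux μ' σ' h' hac')
      fun g hg hgc => ?_
    have e1 : ∀ (ν : Measure (Space n)) (τ : Space n → Space n), IsGaussGreen A ν τ → ν ≪ κ →
      ∫ x, g x • (ν.rnDeriv κ x).toReal • τ x ∂κ = ∫ x, g x • τ x ∂ν := by
      intro ν τ hgg hν
      have := hgg.locallyFinite
      rw [← integral_rnDeriv_smul hν]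
      simp only [smul_comm (g _)]
    rw [e1 μ σ h hac, e1 μ' σ' h' hac']
    exact h.integral_smul_eq h' (hg.of_le (by exact_mod_cast le_top)) hgc
  have hn1 := h.norm_eq_one
  have hn2 := h'.norm_eq_one
  rw [← hd, ae_withDensity_iff (Measure.measurable_rnDeriv _ _)] at hn1
  rw [← hd', ae_withDensity_iff (Measure.measurable_rnDeriv _ _)] at hn2
  have heq : μ.rnDeriv κ =ᵐ[κ] μ'.rnDeriv κ := by
    filter_upwards [hae, hn1, hn2, Measure.rnDeriv_ne_top μ κ, Measure.rnDeriv_ne_top μ' κ]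
      with x h1 h2 h3 h4 h5
    have e1 : ‖(μ.rnDeriv κ x).toReal • σ x‖ = (μ.rnDeriv κ x).toReal := by
      rw [norm_smul, Real.norm_of_nonneg ENNReal.toReal_nonneg]
      by_cases h0 : μ.rnDeriv κ x = 0
      · simp [h0]
      · rw [h2 h0, mul_one]
    have e2 : ‖(μ'.rnDeriv κ x).toReal • σ' x‖ = (μ'.rnDeriv κ x).toReal := by
      rw [norm_smul, Real.norm_of_nonneg ENNReal.toReal_nonneg]
      by_cases h0 : μ'.rnDeriv κ x = 0
      · simp [h0]
      · rw [h3 h0, mul_one]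
    rw [← ENNReal.toReal_eq_toReal_iff' h4 h5, ← e1, ← e2, h1]
  refine ⟨?_, ?_⟩
  · rw [← hd, ← hd']
    exact withDensity_congr_ae heq
  · show ∀ᵐ x ∂μ, σ x = σ' x
    rw [← hd, ae_withDensity_iff (Measure.measurable_rnDeriv _ _)]
    filter_upwards [hae, heq, Measure.rnDeriv_ne_top μ κ] with x h1 h2 h4 h0
    rw [← h2] at h1
    exact smul_right_injective _ (ENNReal.toReal_ne_zero.2 ⟨h0, h4⟩) h1

/-- By uniqueness the means may be computed with the given continuous field. Over small balls they
stay in any prescribed closed ball about `σ x`, which is convex. -/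
theorem IsOuterNormalAt.eq_of_continuousAt {A : Set (Space n)} {μ : Measure (Space n)}
    {σ : Space n → Space n} (h : IsGaussGreen A μ σ) {x : Space n} {ν : Dir n}
    (hx : IsOuterNormalAt A x ν) (hc : ContinuousAt σ x) : (ν : Space n) = σ x := by
  obtain ⟨μ', σ', hg, hpos, hlim⟩ := hx
  obtain ⟨rfl, hσ⟩ := h.unique hg
  have := h.locallyFinite
  have heq : ∀ r : ℝ, ⨍ y in ball x r, σ' y ∂μ = ⨍ y in ball x r, σ y ∂μ := fun r =>
    average_congr (ae_restrict_of_ae (hσ.mono fun _ hy => hy.symm))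
  simp only [heq] at hlim
  refine tendsto_nhds_unique hlim ?_
  rw [Metric.nhds_basis_closedBall.tendsto_right_iff]
  intro ε hε
  obtain ⟨δ, hδ, hball⟩ := Metric.continuousAt_iff.1 hc ε hε
  filter_upwards [Ioo_mem_nhdsGT hδ] with r hr
  refine (convex_closedBall (σ x) ε).set_average_mem isClosed_closedBall (hpos r hr.1).ne'
    measure_ball_lt_top.ne ?_ ?_
  · filter_upwards [ae_restrict_mem measurableSet_ball] with y hy
    exact (hball ((mem_ball.1 hy).trans hr.2)).le
  · exact (h.locallyIntegrable.integrableOn_isCompact (isCompact_closedBall x r)).mono_set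
      ball_subset_closedBall

/-! ### Polar coordinates and the divergence theorem on centred balls. -/

theorem nontrivial_space (hn : 1 ≤ n) : Nontrivial (Space n) := by
  have : NeZero n := ⟨by omega⟩
  have : Nonempty (Fin n) := ⟨0⟩
  infer_instance

theorem lintegral_polar (hn : 1 ≤ n) (F : Space n → ℝ≥0∞) :
    ∫⁻ x, F x = ∫⁻ p : Dir n × Ioi (0 : ℝ), F ((p.2 : ℝ) • (p.1 : Space n))
      ∂((volume : Measure (Space n)).toSphere.prod (Measure.volumeIoiPow (n - 1))) := by
  have := nontrivial_space hn
  have hmp := (volume : Measure (Space n)).measurePreserving_homeomorphUnitSphereProd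
  rw [finrank_euclideanSpace, Fintype.card_fin] at hmp
  have h0 := lintegral_subtype_comap (μ := volume) (s := {(0 : Space n)}ᶜ)
    (measurableSet_singleton _).compl F
  rw [restrict_compl_singleton] at h0
  rw [← hmp.lintegral_comp_emb (Homeomorph.measurableEmbedding _), ← h0]
  refine lintegral_congr fun x => ?_
  congr 1
  have hx : ‖(x : Space n)‖ ≠ 0 := norm_ne_zero_iff.2 x.2
  simp [smul_smul, hx]

theorem integral_polar (hn : 1 ≤ n) (F : Space n → ℝ) :
    ∫ x, F x = ∫ p : Dir n × Ioi (0 : ℝ), F ((p.2 : ℝ) • (p.1 : Space n))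
      ∂((volume : Measure (Space n)).toSphere.prod (Measure.volumeIoiPow (n - 1))) := by
  have := nontrivial_space hn
  have hmp := (volume : Measure (Space n)).measurePreserving_homeomorphUnitSphereProd
  rw [finrank_euclideanSpace, Fintype.card_fin] at hmp
  have h0 := integral_subtype_comap (μ := volume) (s := {(0 : Space n)}ᶜ)
    (measurableSet_singleton _).compl F
  rw [restrict_compl_singleton] at h0
  rw [← hmp.integral_comp (Homeomorph.measurableEmbedding _), ← h0]
  refine integral_congr_ae (Eventually.of_forall fun x => ?_)
  have hx : ‖(x : Space n)‖ ≠ 0 := norm_ne_zero_iff.2 x.2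
  simp [smul_smul, hx]

/-- Integration in polar coordinates. -/
theorem lintegral_eq_lintegral_sphere (hn : 1 ≤ n) {F : Space n → ℝ≥0∞} (hF : Measurable F) :
    ∫⁻ x, F x = ∫⁻ θ : Dir n, ∫⁻ t in Ioi (0 : ℝ),
      ENNReal.ofReal (t ^ (n - 1)) * F (t • (θ : Space n))
      ∂volume ∂(volume : Measure (Space n)).toSphere := by
  rw [lintegral_polar hn, lintegral_prod _ (by fun_prop)]
  refine lintegral_congr fun θ => ?_
  rw [Measure.volumeIoiPow, lintegral_withDensity_eq_lintegral_mul _ (by fun_prop) (by fun_prop)]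
  exact lintegral_subtype_comap measurableSet_Ioi
    (fun t : ℝ => ENNReal.ofReal (t ^ (n - 1)) * F (t • (θ : Space n)))

/-- The spherical shell of inner radius `a` and outer radius `b`. -/
def shell (n : ℕ) (a b : ℝ) : Set (Space n) := {x | ‖x‖ ∈ Ioo a b}

theorem measurableSet_shell (a b : ℝ) : MeasurableSet (shell n a b) :=
  measurable_norm measurableSet_Ioo

theorem integral_shell (hn : 1 ≤ n) {a b : ℝ} (ha : 0 < a) (hab : a ≤ b) (Q : Space n → ℝ) :
    ∫ x in shell n a b, Q ((‖x‖)⁻¹ • x) =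
      (∫ θ : Dir n, Q θ ∂(volume : Measure (Space n)).toSphere) * ((b ^ n - a ^ n) / n) := by
  rw [← integral_indicator (measurableSet_shell a b), integral_polar hn]
  have h1 : ∀ p : Dir n × Ioi (0 : ℝ),
      (shell n a b).indicator (fun x => Q ((‖x‖)⁻¹ • x)) ((p.2 : ℝ) • (p.1 : Space n)) =
      Q p.1 * (Subtype.val ⁻¹' (Ioo a b)).indicator (fun _ : Ioi (0 : ℝ) => (1 : ℝ)) p.2 := by
    rintro ⟨θ, t, ht⟩
    have ht0 : (0 : ℝ) < t := ht
    have hnorm : ‖t • (θ : Space n)‖ = t := by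
      rw [norm_smul, norm_dir, mul_one, Real.norm_of_nonneg ht0.le]
    by_cases hm : t ∈ Ioo a b
    · rw [indicator_of_mem (show t • (θ : Space n) ∈ shell n a b by
          simpa [shell, hnorm] using hm),
        indicator_of_mem (show (⟨t, ht⟩ : Ioi (0 : ℝ)) ∈ Subtype.val ⁻¹' (Ioo a b) from hm),
        hnorm, smul_smul, inv_mul_cancel₀ ht0.ne', one_smul, mul_one]
    · rw [indicator_of_notMem (show t • (θ : Space n) ∉ shell n a b by
          simpa [shell, hnorm] using hm),
        indicator_of_notMem (show (⟨t, ht⟩ : Ioi (0 : ℝ)) ∉ Subtype.val ⁻¹' (Ioo a b) from hm),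
        mul_zero]
  simp only [h1]
  rw [integral_prod_mul (fun θ : Dir n => Q θ)]
  congr 1
  rw [integral_indicator_const _ (measurable_subtype_coe measurableSet_Ioo)]
  simp only [smul_eq_mul, mul_one]
  have hm : MeasurableSet (Subtype.val ⁻¹' (Ioo a b) : Set (Ioi (0 : ℝ))) :=
    measurable_subtype_coe measurableSet_Ioo
  rw [measureReal_def, Measure.volumeIoiPow, withDensity_apply _ hm,
    setLIntegral_subtype measurableSet_Ioi _ fun a : ℝ ↦ .ofReal (a ^ (n - 1))]
  have himg : Subtype.val '' (Subtype.val ⁻¹' (Ioo a b) : Set (Ioi (0 : ℝ))) = Ioo a b := by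
    rw [Subtype.image_preimage_coe]
    exact inter_eq_right.2 fun x hx => ha.trans hx.1
  rw [himg, Measure.restrict_congr_set Ioo_ae_eq_Ioc, ← ofReal_integral_eq_lintegral_ofReal,
    ← intervalIntegral.integral_of_le hab, integral_pow]
  · rw [Nat.sub_add_cancel hn, Nat.cast_sub hn]
    simp only [Nat.cast_one, sub_add_cancel]
    refine ENNReal.toReal_ofReal ?_
    have := pow_le_pow_left₀ ha.le hab n
    have : 0 ≤ b ^ n - a ^ n := by linarith
    positivity
  · exact (intervalIntegral.intervalIntegrable_pow _).1
  · filter_upwards [ae_restrict_mem measurableSet_Ioc] with y hy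
    exact pow_nonneg (ha.le.trans hy.1.le) _

theorem measure_shell (hn : 1 ≤ n) {a b : ℝ} (ha : 0 < a) (hab : a ≤ b) :
    (volume : Measure (Space n)).real (shell n a b) =
      (volume : Measure (Space n)).toSphere.real univ * ((b ^ n - a ^ n) / n) := by
  have := integral_shell hn ha hab (fun _ => (1 : ℝ))
  simpa using this

theorem hasDerivAt_norm_line {x : Space n} (hx : x ≠ 0) (v : Space n) :
    HasDerivAt (fun t : ℝ => ‖x + t • v‖) (inner ℝ ((‖x‖)⁻¹ • x) v) 0 := by
  have h1 : HasDerivAt (fun t : ℝ => x + t • v) v 0 := by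
    simpa using ((hasDerivAt_id (0 : ℝ)).smul_const v).const_add x
  have h2 := h1.norm_sq
  have h3 := h2.sqrt (by simpa using hx)
  have hxn : ‖x‖ ≠ 0 := norm_ne_zero_iff.2 hx
  convert! h3 using 1
  · ext t; rw [Real.sqrt_sq (norm_nonneg _)]
  · rw [real_inner_smul_left]
    simp only [zero_smul, add_zero]
    rw [Real.sqrt_sq (norm_nonneg _)]
    field_simp

/-- The radial cutoff equal to `1` on the ball of radius `r`, to `0` off the ball of radius
`r + δ`, and affine in the norm in between. -/
noncomputable def radialCutoff (n : ℕ) (r δ : ℝ) (x : Space n) : ℝ :=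
  max 0 (min 1 ((r + δ - ‖x‖) / δ))

theorem radialCutoff_mem_Icc (r δ : ℝ) (x : Space n) : radialCutoff n r δ x ∈ Icc (0 : ℝ) 1 :=
  ⟨le_max_left _ _, max_le zero_le_one (min_le_left _ _)⟩

theorem radialCutoff_lipschitz (r : ℝ) {δ : ℝ} (hδ : 0 < δ) :
    LipschitzWith (Real.toNNReal δ⁻¹) (radialCutoff n r δ) := by
  have h1 : LipschitzWith (Real.toNNReal δ⁻¹) fun x : Space n => (r + δ - ‖x‖) / δ := by
    refine LipschitzWith.of_dist_le_mul fun x y => ?_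
    rw [Real.coe_toNNReal _ (inv_pos.2 hδ).le, Real.dist_eq, ← sub_div, abs_div, abs_of_pos hδ,
      dist_eq_norm, div_eq_inv_mul]
    gcongr
    rw [show r + δ - ‖x‖ - (r + δ - ‖y‖) = -(‖x‖ - ‖y‖) by ring, abs_neg]
    exact abs_norm_sub_norm_le x y
  exact (h1.const_min 1).const_max 0

theorem lineDeriv_radialCutoff {r δ : ℝ} (hδ : 0 < δ) {x : Space n} (hx : x ≠ 0)
    (h1 : ‖x‖ ≠ r) (h2 : ‖x‖ ≠ r + δ) (v : Space n) :
    lineDeriv ℝ (radialCutoff n r δ) x v =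
      (shell n r (r + δ)).indicator (fun x => -δ⁻¹ * inner ℝ ((‖x‖)⁻¹ • x) v) x := by
  have hd := hasDerivAt_norm_line hx v
  have hc : ContinuousAt (fun t : ℝ => ‖x + t • v‖) 0 := hd.continuousAt
  have h0 : ‖x + (0 : ℝ) • v‖ = ‖x‖ := by simp
  refine HasLineDerivAt.lineDeriv ?_
  show HasDerivAt (fun t : ℝ => radialCutoff n r δ (x + t • v)) _ 0
  rcases lt_or_gt_of_ne h1 with h | h
  · rw [indicator_of_notMem (fun hm => h.not_gt hm.1)]
    refine (hasDerivAt_const (0 : ℝ) (1 : ℝ)).congr_of_eventuallyEq ?_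
    filter_upwards [hc.eventually_lt_const (h0.symm ▸ h)] with t ht
    rw [radialCutoff, min_eq_left, max_eq_right zero_le_one]
    rw [le_div_iff₀ hδ]; linarith
  rcases lt_or_gt_of_ne h2 with h' | h'
  · rw [indicator_of_mem (show x ∈ shell n r (r + δ) from ⟨h, h'⟩)]
    have hd' : HasDerivAt (fun t : ℝ => (r + δ - ‖x + t • v‖) / δ)
        (-δ⁻¹ * inner ℝ ((‖x‖)⁻¹ • x) v) 0 := by
      convert! (hd.const_sub (r + δ)).div_const δ using 1
      ring
    refine hd'.congr_of_eventuallyEq ?_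
    filter_upwards [hc.eventually_lt_const (h0.symm ▸ h'), hc.eventually_const_lt (h0.symm ▸ h)]
      with t ht ht'
    rw [radialCutoff, min_eq_right, max_eq_right]
    · apply div_nonneg _ hδ.le; linarith
    · rw [div_le_one hδ]; linarith
  · rw [indicator_of_notMem (fun hm => h'.not_gt hm.2)]
    refine (hasDerivAt_const (0 : ℝ) (0 : ℝ)).congr_of_eventuallyEq ?_
    filter_upwards [hc.eventually_const_lt (h0.symm ▸ h')] with t ht
    rw [radialCutoff, max_eq_left]
    refine (min_le_right _ _).trans ?_
    apply div_nonpos_of_nonpos_of_nonneg _ hδ.le; linarith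

theorem continuous_divergence {u : Space n → Space n} (hu : ContDiff ℝ 1 u) :
    Continuous (divergence u) := by
  have h := hu.continuous_fderiv (by norm_num)
  unfold divergence
  fun_prop

theorem hasCompactSupport_divergence {u : Space n → Space n} (hu : HasCompactSupport u) :
    HasCompactSupport (divergence u) := by
  refine (hu.fderiv (𝕜 := ℝ)).mono fun x hx => ?_
  contrapose! hx
  simp only [Function.mem_support, ne_eq, not_not] at hx ⊢
  simp [divergence, hx]

theorem contDiff_coord {u : Space n → Space n} (hu : ContDiff ℝ 1 u) (i : Fin n) :
    ContDiff ℝ 1 fun x => u x i := by fun_prop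

theorem hasCompactSupport_coord {u : Space n → Space n} (huc : HasCompactSupport u) (i : Fin n) :
    HasCompactSupport fun x => u x i :=
  huc.comp_left (g := fun y : Space n => y i) rfl

theorem ae_norm_ne (hn : 1 ≤ n) (s : ℝ) : ∀ᵐ x : Space n, ‖x‖ ≠ s := by
  have := nontrivial_space hn
  rw [ae_iff]
  convert! Measure.addHaar_sphere volume (0 : Space n) s using 2
  ext x; simp

/-- Integration by parts against the Lipschitz cutoff, whose gradient is `-δ⁻¹ x / ‖x‖` on the shell
and zero off it, apart from null spheres. -/
theorem integral_shell_coord (hn : 1 ≤ n) {u : Space n → Space n} (hu : ContDiff ℝ 1 u)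
    (huc : HasCompactSupport u) {r δ : ℝ} (hδ : 0 < δ) (i : Fin n) (e : Space n) :
    ∫ x in shell n r (r + δ), δ⁻¹ * (inner ℝ ((‖x‖)⁻¹ • x) e * u x i) =
      ∫ x, radialCutoff n r δ x * (fderiv ℝ u x e) i := by
  obtain ⟨D, hD⟩ := ContDiff.lipschitzWith_of_hasCompactSupport (hasCompactSupport_coord huc i)
    (contDiff_coord hu i) one_ne_zero
  have h := (radialCutoff_lipschitz (n := n) r hδ).integral_lineDeriv_mul_eq (μ := volume)
    hD (hasCompactSupport_coord huc i) e
  have e1 : ∫ x, lineDeriv ℝ (radialCutoff n r δ) x e * u x i =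
      -∫ x in shell n r (r + δ), δ⁻¹ * (inner ℝ ((‖x‖)⁻¹ • x) e * u x i) := by
    rw [← integral_neg, ← integral_indicator (measurableSet_shell r (r + δ))]
    refine integral_congr_ae ?_
    filter_upwards [ae_norm_ne hn 0, ae_norm_ne hn r, ae_norm_ne hn (r + δ)] with x h1 h2 h3
    rw [lineDeriv_radialCutoff hδ (norm_ne_zero_iff.1 h1) h2 h3]
    by_cases hx : x ∈ shell n r (r + δ)
    · simp only [indicator_of_mem hx]; ring
    · simp only [indicator_of_notMem hx]; ring
  have e2 : ∫ x, lineDeriv ℝ (fun x => u x i) x (-e) * radialCutoff n r δ x =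
      -∫ x, radialCutoff n r δ x * (fderiv ℝ u x e) i := by
    rw [← integral_neg]
    refine integral_congr_ae (Eventually.of_forall fun x => ?_)
    have hdx : DifferentiableAt ℝ u x := hu.differentiable (by norm_num) x
    have hfd : HasFDerivAt (fun x => u x i)
        ((EuclideanSpace.proj i : Space n →L[ℝ] ℝ).comp (fderiv ℝ u x)) x :=
      (EuclideanSpace.proj i : Space n →L[ℝ] ℝ).hasFDerivAt.comp x hdx.hasFDerivAt
    simp only []
    rw [hfd.differentiableAt.lineDeriv_eq_fderiv, hfd.fderiv]
    simp [mul_comm]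
  rw [e1, e2] at h
  exact neg_injective h

theorem integrable_shell_coord {u : Space n → Space n} (hu : ContDiff ℝ 1 u)
    (huc : HasCompactSupport u) (r δ : ℝ) (i : Fin n) {e : Space n} (he : ‖e‖ = 1) :
    Integrable (fun x => δ⁻¹ * (inner ℝ ((‖x‖)⁻¹ • x) e * u x i))
      (volume.restrict (shell n r (r + δ))) := by
  have hc := (contDiff_coord hu i).continuous
  refine Integrable.const_mul ?_ _
  refine (Integrable.mono' (g := fun x => |u x i|) ?_ ?_ ?_)
  · exact ((hc.integrable_of_hasCompactSupport (hasCompactSupport_coord huc i)).abs).restrict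
  · refine Measurable.aestronglyMeasurable ?_
    exact ((measurable_norm.inv.smul measurable_id).inner measurable_const).mul hc.measurable
  · refine Eventually.of_forall fun x => ?_
    rw [norm_mul, Real.norm_eq_abs, Real.norm_eq_abs]
    refine mul_le_of_le_one_left (abs_nonneg _) ?_
    refine (abs_real_inner_le_norm _ _).trans ?_
    rw [he, mul_one, norm_smul, norm_inv, norm_norm]
    exact inv_mul_le_one

theorem integrable_radialCutoff_mul {u : Space n → Space n} (hu : ContDiff ℝ 1 u)
    (huc : HasCompactSupport u) (r : ℝ) {δ : ℝ} (hδ : 0 < δ) (i : Fin n) (e : Space n) :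
    Integrable fun x => radialCutoff n r δ x * (fderiv ℝ u x e) i := by
  have h := hu.continuous_fderiv (by norm_num)
  refine Continuous.integrable_of_hasCompactSupport
    ((radialCutoff_lipschitz r hδ).continuous.mul (by fun_prop)) ?_
  refine HasCompactSupport.mul_left ?_
  refine (huc.fderiv (𝕜 := ℝ)).mono fun x hx => ?_
  contrapose! hx
  simp only [Function.mem_support, ne_eq, not_not] at hx ⊢
  simp [hx]

theorem integral_shell_inner (hn : 1 ≤ n) {u : Space n → Space n} (hu : ContDiff ℝ 1 u)
    (huc : HasCompactSupport u) {r δ : ℝ} (hδ : 0 < δ) :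
    δ⁻¹ * ∫ x in shell n r (r + δ), inner ℝ (u x) ((‖x‖)⁻¹ • x) =
      ∫ x, radialCutoff n r δ x * divergence u x := by
  calc δ⁻¹ * ∫ x in shell n r (r + δ), inner ℝ (u x) ((‖x‖)⁻¹ • x)
      = ∫ x in shell n r (r + δ), ∑ i, δ⁻¹ * (inner ℝ ((‖x‖)⁻¹ • x)
          (EuclideanSpace.single i (1 : ℝ)) * u x i) := by
        rw [← integral_const_mul]
        refine integral_congr_ae (Eventually.of_forall fun x => ?_)
        simp only [← Finset.mul_sum, PiLp.inner_apply, PiLp.single_apply]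
        simp
    _ = ∑ i, ∫ x, radialCutoff n r δ x * (fderiv ℝ u x (EuclideanSpace.single i 1)) i := by
        rw [integral_finsetSum _ fun i _ => integrable_shell_coord hu huc r δ i (by simp)]
        exact Finset.sum_congr rfl fun i _ => integral_shell_coord hn hu huc hδ i _
    _ = _ := by
        rw [← integral_finsetSum _ fun i _ => integrable_radialCutoff_mul hu huc r hδ i _]
        simp only [divergence, Finset.mul_sum]

theorem tendsto_integral_radialCutoff (hn : 1 ≤ n) {u : Space n → Space n}
    (hu : ContDiff ℝ 1 u) (huc : HasCompactSupport u) (r : ℝ) :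
    Tendsto (fun δ : ℝ => ∫ x, radialCutoff n r δ x * divergence u x) (𝓝[>] 0)
      (𝓝 (∫ x in ball (0 : Space n) r, divergence u x)) := by
  have hd := continuous_divergence hu
  rw [← integral_indicator measurableSet_ball]
  refine tendsto_integral_filter_of_dominated_convergence (fun x => |divergence u x|) ?_ ?_ ?_ ?_
  · filter_upwards [self_mem_nhdsWithin] with δ hδ
    exact ((radialCutoff_lipschitz r hδ).continuous.mul hd).aestronglyMeasurable
  · refine Eventually.of_forall fun δ => Eventually.of_forall fun x => ?_
    rw [norm_mul, Real.norm_eq_abs, Real.norm_eq_abs]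
    refine mul_le_of_le_one_left (abs_nonneg _) ?_
    have := radialCutoff_mem_Icc r δ x
    rw [abs_of_nonneg this.1]; exact this.2
  · exact (hd.integrable_of_hasCompactSupport (hasCompactSupport_divergence huc)).abs
  · filter_upwards [ae_norm_ne hn r] with x hx
    refine tendsto_const_nhds.congr' ?_
    rcases lt_or_gt_of_ne hx with h | h
    · rw [indicator_of_mem (by simpa using h)]
      filter_upwards [self_mem_nhdsWithin] with δ hδ
      have hδ : 0 < δ := hδ
      rw [radialCutoff, min_eq_left, max_eq_right zero_le_one, one_mul]
      rw [le_div_iff₀ hδ]; linarith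
    · rw [indicator_of_notMem (by simpa using h.le)]
      filter_upwards [Ioo_mem_nhdsGT (sub_pos.2 h)] with δ hδ
      rw [radialCutoff, max_eq_left, zero_mul]
      refine (min_le_right _ _).trans ?_
      apply div_nonpos_of_nonpos_of_nonneg _ hδ.1.le; linarith [hδ.2]

theorem tendsto_shell_volume (hn : 1 ≤ n) (r : ℝ) :
    Tendsto (fun δ : ℝ => δ⁻¹ * (((r + δ) ^ n - r ^ n) / n)) (𝓝[>] 0) (𝓝 (r ^ (n - 1))) := by
  have hn0 : (n : ℝ) ≠ 0 := by positivity
  have h := ((hasDerivAt_pow n r).tendsto_slope_zero_right).div_const (n : ℝ)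
  rw [mul_div_cancel_left₀ _ hn0] at h
  refine h.congr fun δ => ?_
  rw [smul_eq_mul]; ring

/-- Let the shell thickness `δ` tend to 0 in `integral_shell_inner`. Replacing `u x` by its value at
the radial projection of `x` on the inner sphere costs at most the Lipschitz constant times `δ`, and
the remaining shell integral splits exactly in polar coordinates. -/
theorem integral_ball_divergence (hn : 1 ≤ n) {u : Space n → Space n} (hu : ContDiff ℝ 1 u)
    (huc : HasCompactSupport u) {r : ℝ} (hr : 0 < r) :
    ∫ x in ball (0 : Space n) r, divergence u x =
      r ^ (n - 1) * ∫ θ : Dir n, inner ℝ (u (r • (θ : Space n))) (θ : Space n)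
        ∂(volume : Measure (Space n)).toSphere := by
  obtain ⟨L, hL⟩ := ContDiff.lipschitzWith_of_hasCompactSupport huc hu one_ne_zero
  obtain ⟨M, hM⟩ := hu.continuous.bounded_above_of_compact_support huc
  set N : Space n → Space n := fun x => (‖x‖)⁻¹ • x with hN
  have hNm : Measurable N := measurable_norm.inv.smul measurable_id
  have hN1 : ∀ x, ‖N x‖ ≤ 1 := fun x => by
    rw [hN, norm_smul, norm_inv, norm_norm]; exact inv_mul_le_one
  set I := ∫ θ : Dir n, inner ℝ (u (r • (θ : Space n))) (θ : Space n)
        ∂(volume : Measure (Space n)).toSphere with hI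
  have hfin : ∀ δ : ℝ, volume (shell n r (r + δ)) < ⊤ := fun δ =>
    (measure_mono (t := closedBall 0 (r + δ)) fun x hx => by simpa using hx.2.le).trans_lt
      measure_closedBall_lt_top
  have hint1 : ∀ δ, IntegrableOn (fun x => inner ℝ (u x) (N x)) (shell n r (r + δ)) := fun δ => by
    refine Measure.integrableOn_of_bounded (M := M) (hfin δ).ne
      (hu.continuous.measurable.inner hNm).aestronglyMeasurable
      (Eventually.of_forall fun x => ?_)
    refine (abs_real_inner_le_norm _ _).trans ?_
    exact (mul_le_of_le_one_right (norm_nonneg _) (hN1 x)).trans (hM x)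
  have hint2 : ∀ δ, IntegrableOn (fun x => inner ℝ (u (r • N x)) (N x)) (shell n r (r + δ)) :=
    fun δ => by
    refine Measure.integrableOn_of_bounded (M := M) (hfin δ).ne
      ((hu.continuous.measurable.comp (hNm.const_smul r)).inner hNm).aestronglyMeasurable
      (Eventually.of_forall fun x => ?_)
    refine (abs_real_inner_le_norm _ _).trans ?_
    exact (mul_le_of_le_one_right (norm_nonneg _) (hN1 x)).trans (hM _)
  have hA : Tendsto (fun δ : ℝ => δ⁻¹ * ∫ x in shell n r (r + δ), inner ℝ (u (r • N x)) (N x))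
      (𝓝[>] 0) (𝓝 (r ^ (n - 1) * I)) := by
    refine ((tendsto_shell_volume hn r).mul_const I).congr' ?_
    filter_upwards [self_mem_nhdsWithin] with δ hδ
    have hδ : 0 < δ := hδ
    rw [integral_shell hn hr (by linarith) fun y => inner ℝ (u (r • y)) y]
    ring
  have hB : Tendsto (fun δ : ℝ => δ⁻¹ * ∫ x in shell n r (r + δ),
      (inner ℝ (u x) (N x) - inner ℝ (u (r • N x)) (N x))) (𝓝[>] 0) (𝓝 0) := by
    have hlim : Tendsto (fun δ : ℝ => (L : ℝ) * (δ * ((volume : Measure (Space n)).toSphere.real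
        univ * (δ⁻¹ * (((r + δ) ^ n - r ^ n) / n))))) (𝓝[>] 0) (𝓝 0) := by
      have h0 : Tendsto (fun δ : ℝ => δ) (𝓝[>] 0) (𝓝 0) := tendsto_id.mono_left nhdsWithin_le_nhds
      simpa using (h0.mul ((tendsto_shell_volume hn r).const_mul _)).const_mul (L : ℝ)
    refine squeeze_zero_norm' ?_ hlim
    filter_upwards [self_mem_nhdsWithin] with δ hδ
    have hδ : 0 < δ := hδ
    have hb : ‖∫ x in shell n r (r + δ),
        (inner ℝ (u x) (N x) - inner ℝ (u (r • N x)) (N x))‖ ≤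
        (L * δ) * volume.real (shell n r (r + δ)) := by
      refine norm_setIntegral_le_of_norm_le_const (hfin δ) fun x hx => ?_
      have hx0 : 0 < ‖x‖ := hr.trans hx.1
      rw [← inner_sub_left]
      refine (abs_real_inner_le_norm _ _).trans ?_
      refine (mul_le_of_le_one_right (norm_nonneg _) (hN1 x)).trans ?_
      rw [← dist_eq_norm]
      refine (hL.dist_le_mul _ _).trans ?_
      gcongr
      have hxe : x - r • N x = (‖x‖ - r) • N x := by
        rw [sub_smul, hN]
        simp only [smul_smul]
        rw [mul_inv_cancel₀ hx0.ne', one_smul]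
      rw [dist_eq_norm, hxe, norm_smul, Real.norm_of_nonneg (by linarith [hx.1])]
      refine (mul_le_of_le_one_right (by linarith [hx.1]) (hN1 x)).trans ?_
      linarith [hx.2]
    rw [measure_shell hn hr (by linarith)] at hb
    rw [norm_mul, Real.norm_of_nonneg (inv_pos.2 hδ).le]
    refine (mul_le_mul_of_nonneg_left hb (inv_pos.2 hδ).le).trans (le_of_eq ?_)
    ring
  have hC := hA.add hB
  rw [add_zero] at hC
  refine tendsto_nhds_unique (tendsto_integral_radialCutoff hn hu huc r) (hC.congr' ?_)
  filter_upwards [self_mem_nhdsWithin] with δ hδ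
  rw [integral_sub (hint1 δ) (hint2 δ), ← integral_shell_inner hn hu huc hδ]
  ring

/-! ### Perimeter of balls. -/

/-- The parametrization of the sphere of centre `c` and radius `r` by directions. -/
noncomputable def sphereMap (c : Space n) (r : ℝ) (θ : Dir n) : Space n := c + r • (θ : Space n)

theorem continuous_sphereMap (c : Space n) (r : ℝ) : Continuous (sphereMap c r) := by
  unfold sphereMap; fun_prop

theorem sphereMap_injective (c : Space n) {r : ℝ} (hr : r ≠ 0) :
    Function.Injective (sphereMap c r) := fun θ η h => by
  apply Subtype.ext
  exact smul_right_injective _ hr (add_left_cancel h)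

theorem measurableEmbedding_sphereMap (c : Space n) {r : ℝ} (hr : r ≠ 0) :
    MeasurableEmbedding (sphereMap c r) :=
  (continuous_sphereMap c r).measurableEmbedding (sphereMap_injective c hr)

theorem sphereMap_sub (c : Space n) {r : ℝ} (hr : r ≠ 0) (θ : Dir n) :
    r⁻¹ • (sphereMap c r θ - c) = θ := by
  rw [sphereMap, add_sub_cancel_left, smul_smul, inv_mul_cancel₀ hr, one_smul]

/-- The surface measure of the sphere of centre `c` and radius `r`. -/
noncomputable def surfaceMeasure (c : Space n) (r : ℝ) : Measure (Space n) :=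
  ENNReal.ofReal (r ^ (n - 1)) • (volume : Measure (Space n)).toSphere.map (sphereMap c r)

instance (c : Space n) (r : ℝ) : IsFiniteMeasure (surfaceMeasure c r) := by
  unfold surfaceMeasure
  exact Measure.smul_finite _ ENNReal.ofReal_ne_top

/-- The divergence theorem on balls. -/
theorem isGaussGreen_ball (hn : 1 ≤ n) (c : Space n) {r : ℝ} (hr : 0 < r) :
    IsGaussGreen (ball c r) (surfaceMeasure c r) (fun x => r⁻¹ • (x - c)) where
  locallyFinite := inferInstance
  measurable := by fun_prop
  norm_eq_one := by
    refine Measure.ae_smul_measure ?_ _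
    rw [(measurableEmbedding_sphereMap c hr.ne').ae_map_iff]
    refine Eventually.of_forall fun θ => ?_
    rw [sphereMap_sub c hr.ne', norm_dir]
  integral_divergence φ hφ hφc := by
    set u : Space n → Space n := fun x => φ (c + x) with hu
    have hu1 : ContDiff ℝ 1 u := hφ.comp (contDiff_const.add contDiff_id)
    have huc : HasCompactSupport u := hφc.comp_homeomorph (Homeomorph.addLeft c)
    have hdiv : ∀ x, divergence u x = divergence φ (c + x) := fun x => by
      simp only [divergence, hu, fderiv_comp_add_left]
    have hball : (fun x => c + x) ⁻¹' ball c r = ball (0 : Space n) r := by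
      ext x; simp
    rw [← (measurePreserving_add_left volume c).setIntegral_preimage_emb
      (measurableEmbedding_addLeft c), hball]
    simp only [← hdiv]
    rw [integral_ball_divergence hn hu1 huc hr, surfaceMeasure, integral_smul_measure,
      (measurableEmbedding_sphereMap c hr.ne').integral_map,
      ENNReal.toReal_ofReal (by positivity), smul_eq_mul]
    simp only [sphereMap_sub c hr.ne']
    rfl

theorem hasFinitePerimeter_ball (hn : 1 ≤ n) (c : Space n) {r : ℝ} (hr : 0 < r) :
    HasFinitePerimeter (ball c r) :=
  ⟨_, _, isGaussGreen_ball hn c hr, inferInstance⟩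

/-- The normal field `r⁻¹ • (x - c)` is continuous on the whole space, so an outer normal at `x`
equals its value there, which places `x` on the sphere. -/
theorem IsOuterNormalAt.exists_sphereMap (hn : 1 ≤ n) {c : Space n} {r : ℝ} (hr : 0 < r)
    {x : Space n} {ν : Dir n} (h : IsOuterNormalAt (ball c r) x ν) : sphereMap c r ν = x := by
  have hg := isGaussGreen_ball hn c hr
  have hν := h.eq_of_continuousAt hg (by fun_prop)
  rw [sphereMap, hν, smul_smul, mul_inv_cancel₀ hr.ne', one_smul, add_sub_cancel]

theorem hausdorff_restrict_sphere_le (hn : 1 ≤ n) (c : Space n) {r : ℝ} (hr : 0 < r) :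
    (μHE[n - 1] : Measure (Space n)).restrict (range (sphereMap c r)) ≤ surfaceMeasure c r := by
  have hemb := measurableEmbedding_sphereMap c hr.ne'
  refine Measure.le_iff.2 fun B hB => ?_
  rw [Measure.restrict_apply hB, surfaceMeasure, Measure.smul_apply, hemb.map_apply, smul_eq_mul]
  have himg : B ∩ range (sphereMap c r) =
      c +ᵥ (r • (Subtype.val '' (sphereMap c r ⁻¹' B) : Set (Space n))) := by
    ext x
    simp only [mem_inter_iff, mem_range, Set.mem_vadd_set, Set.mem_smul_set, mem_image,
      mem_preimage]
    constructor
    · rintro ⟨hx, θ, rfl⟩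
      exact ⟨_, ⟨_, ⟨θ, hx, rfl⟩, rfl⟩, rfl⟩
    · rintro ⟨_, ⟨_, ⟨θ, hx, rfl⟩, rfl⟩, rfl⟩
      exact ⟨hx, θ, rfl⟩
  rw [himg, measure_vadd, Measure.euclideanHausdorffMeasure_smul₀ (n - 1) hr.ne',
    ENNReal.smul_def, smul_eq_mul, ENNReal.coe_pow, ENNReal.ofReal_pow hr.le,
    ← enorm_eq_nnnorm, Real.enorm_of_nonneg hr.le]
  gcongr
  exact hausdorff_le_toSphere hn (hemb.measurable hB)

theorem weightedPerimeter_ball_le (hn : 1 ≤ n) (h : Space n × Dir n → ℝ≥0) (c : Space n) {r : ℝ}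
    (hr : 0 < r) :
    weightedPerimeter h (ball c r) ≤ ENNReal.ofReal (r ^ (n - 1)) *
      ∫⁻ θ : Dir n, (h (sphereMap c r θ, θ) : ℝ≥0∞) ∂(volume : Measure (Space n)).toSphere := by
  have hemb := measurableEmbedding_sphereMap c hr.ne'
  have hsub : reducedBoundary (ball c r) ⊆ range (sphereMap c r) := by
    rintro x ⟨ν, hν⟩
    exact ⟨ν, hν.exists_sphereMap hn hr⟩
  calc weightedPerimeter h (ball c r)
      ≤ ∫⁻ x in range (sphereMap c r), atOuterNormal h (ball c r) x ∂(μHE[n - 1]) :=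
        lintegral_mono_set hsub
    _ ≤ ∫⁻ x, atOuterNormal h (ball c r) x ∂(surfaceMeasure c r) :=
        lintegral_mono' (hausdorff_restrict_sphere_le hn c hr) le_rfl
    _ = ENNReal.ofReal (r ^ (n - 1)) * ∫⁻ θ : Dir n, atOuterNormal h (ball c r)
          (sphereMap c r θ) ∂(volume : Measure (Space n)).toSphere := by
        rw [surfaceMeasure, lintegral_smul_measure, hemb.lintegral_map, smul_eq_mul]
    _ ≤ _ := by
        gcongr with θ
        unfold atOuterNormal
        split_ifs with hx
        · have := sphereMap_injective c hr.ne' (hx.choose_spec.exists_sphereMap hn hr)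
          rw [this]
        · exact zero_le

/-! ### Balls of prescribed weighted volume. -/

/-- Bernoulli's inequality for `b / a`: the power function lies above its tangent at `a`. -/
theorem pow_add_mul_sub_le_pow (n : ℕ) {a b : ℝ} (ha : 0 < a) (hb : 0 ≤ b) :
    a ^ n + n * a ^ (n - 1) * (b - a) ≤ b ^ n := by
  rcases Nat.eq_zero_or_pos n with rfl | hn
  · simp
  have h0 : 0 ≤ b / a := by positivity
  have h := one_add_mul_le_pow (a := b / a - 1) (by linarith) n
  have h2 : a ^ n * (1 + n * (b / a - 1)) ≤ a ^ n * (1 + (b / a - 1)) ^ n := by gcongr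
  have e1 : a ^ n * (1 + (b / a - 1)) ^ n = b ^ n := by
    rw [← mul_pow]; congr 1; field_simp; ring
  have e2 : a ^ n * (1 + n * (b / a - 1)) = a ^ n + n * a ^ (n - 1) * (b - a) := by
    obtain ⟨k, rfl⟩ : ∃ k, n = k + 1 := ⟨n - 1, by omega⟩
    simp only [Nat.add_sub_cancel, pow_succ]
    field_simp
  linarith

theorem omega_pos (n : ℕ) : 0 < omega n :=
  ENNReal.toReal_pos (measure_ball_pos _ _ one_pos).ne' measure_ball_lt_top.ne

theorem measureReal_ball (c : Space n) {r : ℝ} (hr : 0 ≤ r) (hn : 1 ≤ n) :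
    (volume : Measure (Space n)).real (ball c r) = omega n * r ^ n := by
  have := nontrivial_space hn
  rw [omega, measureReal_def, measureReal_def, Measure.addHaar_ball _ _ hr, ENNReal.toReal_mul,
    ENNReal.toReal_ofReal (by positivity), finrank_euclideanSpace, Fintype.card_fin, mul_comm]

theorem integrableOn_ball_of_bounded {k : Space n → ℝ} {η : ℝ} (hη1 : η ≤ 1) (hk : Measurable k)
    (hkb : ∀ x, k x ∈ Icc (1 - η) 1) (c : Space n) (r : ℝ) : IntegrableOn k (ball c r) := by
  refine Measure.integrableOn_of_bounded (M := 1) measure_ball_lt_top.ne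
    hk.aestronglyMeasurable (Eventually.of_forall fun x => ?_)
  rw [Real.norm_of_nonneg (by linarith [(hkb x).1])]
  exact (hkb x).2

/-- The common part cancels; on the two remaining pieces use `k ≥ 1 - η` and `k ≤ 1` respectively.
Written this way, the piece lost when the centre moves carries only the small factor `η`, which
makes the radius a slowly varying function of the centre. -/
theorem integral_ball_sub_ge {k : Space n → ℝ} {η : ℝ} (hη1 : η ≤ 1) (hk : Measurable k)
    (hkb : ∀ x, k x ∈ Icc (1 - η) 1) (c c' : Space n) (r r' : ℝ) :
    (1 - η) * ((volume : Measure (Space n)).real (ball c r) - volume.real (ball c' r')) -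
      η * volume.real (ball c' r' \ ball c r) ≤
    (∫ x in ball c r, k x) - ∫ x in ball c' r', k x := by
  have hint := fun c r => integrableOn_ball_of_bounded hη1 hk hkb c r
  have hs : ∀ c c' : Space n, ∀ r r' : ℝ, ∫ x in ball c r, k x =
      (∫ x in ball c r ∩ ball c' r', k x) + ∫ x in ball c r \ ball c' r', k x := fun c c' r r' =>
    (integral_inter_add_sdiff measurableSet_ball (hint c r)).symm
  have hv : ∀ c c' : Space n, ∀ r r' : ℝ, (volume : Measure (Space n)).real (ball c r) =
      volume.real (ball c r ∩ ball c' r') + volume.real (ball c r \ ball c' r') :=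
    fun c c' r r' => (measureReal_inter_add_sdiff measurableSet_ball measure_ball_lt_top.ne).symm
  have hfin : ∀ c c' : Space n, ∀ r r' : ℝ, volume (ball c r \ ball c' r') ≠ ⊤ := fun c c' r r' =>
    ((measure_mono sdiff_subset).trans_lt measure_ball_lt_top).ne
  have hdm : ∀ c c' : Space n, ∀ r r' : ℝ, MeasurableSet (ball c r \ ball c' r') :=
    fun c c' r r' => measurableSet_ball.diff measurableSet_ball
  have hlow : (1 - η) * volume.real (ball c r \ ball c' r') ≤
      ∫ x in ball c r \ ball c' r', k x := by
    have := setIntegral_mono_on (integrableOn_const (C := 1 - η) (hfin c c' r r'))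
      ((hint c r).mono_set sdiff_subset) (hdm c c' r r') fun x _ => (hkb x).1
    rw [setIntegral_const, smul_eq_mul] at this
    linarith
  have hup : ∫ x in ball c' r' \ ball c r, k x ≤ volume.real (ball c' r' \ ball c r) := by
    have := setIntegral_mono_on ((hint c' r').mono_set sdiff_subset)
      (integrableOn_const (C := (1 : ℝ)) (hfin c' c r' r)) (hdm c' c r' r) fun x _ => (hkb x).2
    rw [setIntegral_const, smul_eq_mul] at this
    linarith
  rw [hs c c' r r', hs c' c r' r, hv c c' r r', hv c' c r' r, inter_comm (ball c' r')]
  linarith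

/-- A density close to `1` admits, around every point, a ball of prescribed weighted volume, and
its radius is a Lipschitz function of the centre, with small constant. -/
theorem exists_radius (hn : 1 ≤ n) {k : Space n → ℝ} {η : ℝ} (hη0 : 0 ≤ η) (hη1 : η < 1)
    (hk : Measurable k) (hkb : ∀ x, k x ∈ Icc (1 - η) 1) {r₀ r₁ : ℝ} (hr₀ : 0 < r₀)
    (hr₁ : r₀ ≤ r₁) (hr₀₁ : r₀ ^ n ≤ (1 - η) * r₁ ^ n) :
    ∃ r : Space n → ℝ, (∀ c, r c ∈ Icc r₀ r₁) ∧
      (∀ c, ∫ x in ball c (r c), k x = omega n * r₀ ^ n) ∧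
      LipschitzWith (Real.toNNReal (η / (1 - η))) r := by
  have hη1' : 0 < 1 - η := by linarith
  have hω := omega_pos n
  set V : Space n → ℝ → ℝ := fun c r => ∫ x in ball c r, k x with hV
  have hmono : ∀ c s t, 0 ≤ s → s ≤ t →
      (1 - η) * (omega n * t ^ n - omega n * s ^ n) ≤ V c t - V c s := by
    intro c s t hs hst
    have := integral_ball_sub_ge hη1.le hk hkb c c t s
    rw [measureReal_ball c (hs.trans hst) hn, measureReal_ball c hs hn,
      sdiff_eq_empty.2 (ball_subset_ball hst)] at this
    simpa using this
  have hup : ∀ c s t, 0 ≤ s → s ≤ t → V c t - V c s ≤ omega n * t ^ n - omega n * s ^ n := by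
    intro c s t hs hst
    have := integral_ball_sub_ge hη1.le hk hkb c c s t
    have hd : (volume : Measure (Space n)).real (ball c t \ ball c s) =
        omega n * t ^ n - omega n * s ^ n := by
      rw [measureReal_sdiff (ball_subset_ball hst) measurableSet_ball measure_ball_lt_top.ne,
        measureReal_ball c (hs.trans hst) hn, measureReal_ball c hs hn]
    rw [measureReal_ball c (hs.trans hst) hn, measureReal_ball c hs hn, hd] at this
    linarith
  have hbase : ∀ c, V c 0 = 0 := fun c => by simp [hV]
  have hcont : ∀ c, ContinuousOn (V c) (Icc r₀ r₁) := by
    intro c s hs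
    have hs0 : 0 ≤ s := hr₀.le.trans hs.1
    have hb : ∀ t ∈ Icc r₀ r₁, |V c t - V c s| ≤ |omega n * t ^ n - omega n * s ^ n| := by
      intro t ht
      have ht0 : 0 ≤ t := hr₀.le.trans ht.1
      rcases le_total s t with h | h
      · have h1 := hmono c s t hs0 h
        have h2 := hup c s t hs0 h
        have h3 : omega n * s ^ n ≤ omega n * t ^ n := by gcongr
        have h4 := mul_nonneg hη1'.le (sub_nonneg.2 h3)
        rw [abs_of_nonneg (by linarith), abs_of_nonneg (by linarith)]
        exact h2
      · have h1 := hmono c t s ht0 h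
        have h2 := hup c t s ht0 h
        have h3 : omega n * t ^ n ≤ omega n * s ^ n := by gcongr
        have h4 := mul_nonneg hη1'.le (sub_nonneg.2 h3)
        rw [abs_sub_comm, abs_sub_comm (omega n * t ^ n), abs_of_nonneg (by linarith),
          abs_of_nonneg (by linarith)]
        exact h2
    have hlim : Tendsto (fun t : ℝ => |omega n * t ^ n - omega n * s ^ n|) (𝓝[Icc r₀ r₁] s)
        (𝓝 0) := by
      have : Continuous fun t : ℝ => |omega n * t ^ n - omega n * s ^ n| := by fun_prop
      simpa using (this.tendsto s).mono_left nhdsWithin_le_nhds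
    rw [ContinuousWithinAt, tendsto_iff_norm_sub_tendsto_zero]
    refine squeeze_zero' (Eventually.of_forall fun _ => norm_nonneg _) ?_ hlim
    filter_upwards [self_mem_nhdsWithin] with t ht using hb t ht
  have hex : ∀ c, ∃ r ∈ Icc r₀ r₁, V c r = omega n * r₀ ^ n := by
    intro c
    refine intermediate_value_Icc hr₁ (hcont c) ⟨?_, ?_⟩
    · have := hup c 0 r₀ le_rfl hr₀.le
      rw [hbase, zero_pow (by omega)] at this
      linarith
    · have := hmono c 0 r₁ le_rfl (hr₀.le.trans hr₁)
      rw [hbase, zero_pow (by omega)] at this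
      have h2 := mul_le_mul_of_nonneg_left hr₀₁ hω.le
      linarith
  choose r hr hrV using hex
  refine ⟨r, hr, hrV, ?_⟩
  set δ := η / (1 - η) with hδ
  have hδ0 : 0 ≤ δ := div_nonneg hη0 hη1'.le
  have key : ∀ c c', r c ≤ r c' + δ * dist c c' := by
    intro c c'
    by_contra! hcon
    set d := dist c c'
    have hd : 0 ≤ d := dist_nonneg
    -- If `r c` exceeded `ρ`, the ball of radius `ρ` about `c` would have too little weighted
    -- volume. Yet enlarging the radius by `δ d` gains at least as much as moving the centre by `d`
    -- loses.
    set ρ := r c' + δ * d with hρ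
    have hr' : 0 < r c' := hr₀.trans_le (hr c').1
    have hρr : r c' ≤ ρ := le_add_of_nonneg_right (by positivity)
    have h1 := hmono c ρ (r c) (hr'.le.trans hρr) hcon.le
    have h2 : omega n * ρ ^ n < omega n * r c ^ n := by
      gcongr
    have h3 := mul_pos hη1' (sub_pos.2 h2)
    have h4 := integral_ball_sub_ge hη1.le hk hkb c c' ρ (r c')
    have h5 : (volume : Measure (Space n)).real (ball c' (r c') \ ball c ρ) ≤
        omega n * (n * r c' ^ (n - 1) * d) := by
      -- The concentric ball of radius `r c' - d` lies in the moved ball, so what is lost lies in a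
      -- shell of width at most `d`. The truncation at 0 covers `d > r c'`.
      set s := max (r c' - d) 0
      have hs : s ≤ r c' := max_le (by linarith) hr'.le
      have hsub : ball c' (r c') \ ball c ρ ⊆ ball c' (r c') \ ball c' s := by
        refine sdiff_subset_sdiff_right fun x hx => ?_
        rcases le_total (r c' - d) 0 with h | h
        · rw [show s = 0 from max_eq_right h, ball_zero] at hx
          exact absurd hx (notMem_empty x)
        · rw [show s = r c' - d from max_eq_left h, mem_ball] at hx
          rw [mem_ball]
          have := dist_triangle x c' c
          rw [dist_comm c' c] at this
          linarith
      have h6 := measureReal_mono (μ := (volume : Measure (Space n))) hsub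
        ((measure_mono sdiff_subset).trans_lt measure_ball_lt_top).ne
      rw [measureReal_sdiff (ball_subset_ball hs) measurableSet_ball measure_ball_lt_top.ne,
        measureReal_ball c' hr'.le hn, measureReal_ball c' (le_max_right _ _) hn,
        ← mul_sub] at h6
      refine h6.trans ?_
      gcongr
      have h7 := pow_add_mul_sub_le_pow n hr' (le_max_right (r c' - d) 0)
      have h8 : n * r c' ^ (n - 1) * (-d) ≤ n * r c' ^ (n - 1) * (s - r c') := by
        gcongr
        have := le_max_left (r c' - d) 0
        show -d ≤ max (r c' - d) 0 - r c'
        linarith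
      linarith
    have h9 : n * r c' ^ (n - 1) * (δ * d) ≤ ρ ^ n - r c' ^ n := by
      have := pow_add_mul_sub_le_pow n hr' (hr'.le.trans hρr)
      rw [hρ, add_sub_cancel_left] at this
      linarith
    rw [measureReal_ball c (hr'.le.trans hρr) hn, measureReal_ball c' hr'.le hn] at h4
    -- Loss and gain balance exactly for `δ = η / (1 - η)`.
    have h10 : η * (omega n * (n * r c' ^ (n - 1) * d)) =
        (1 - η) * (omega n * (n * r c' ^ (n - 1) * (δ * d))) := by
      rw [hδ]; field_simp
    have h11 := mul_le_mul_of_nonneg_left h5 hη0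
    have h12 := mul_le_mul_of_nonneg_left (mul_le_mul_of_nonneg_left h9 hω.le) hη1'.le
    have e1 : V c (r c) = omega n * r₀ ^ n := hrV c
    have e2 : V c' (r c') = omega n * r₀ ^ n := hrV c'
    have e3 : (∫ x in ball c ρ, k x) = V c ρ := rfl
    have e4 : (∫ x in ball c' (r c'), k x) = V c' (r c') := rfl
    rw [e3, e4] at h4
    linarith
  refine LipschitzWith.of_dist_le_mul fun c c' => ?_
  rw [Real.coe_toNNReal _ hδ0, Real.dist_eq, abs_le]
  constructor
  · have := key c' c
    rw [dist_comm c' c] at this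
    linarith
  · linarith [key c c']

/-! ### Families of spheres with slowly varying radius. -/

/-- A field of radii between `r₀` and `r₁` which is Lipschitz with constant `δ < 1`. -/
structure IsRadiusField (r₀ r₁ : ℝ) (δ : ℝ≥0) (r : Space n → ℝ) : Prop where
  pos : 0 < r₀
  mem_Icc : ∀ c, r c ∈ Icc r₀ r₁
  lipschitz : LipschitzWith δ r
  lt_one : δ < 1

/-- The point of the sphere of centre `c` and radius `r c` in direction `v`. -/
def spherePoint (r : Space n → ℝ) (v c : Space n) : Space n := c + r c • v

namespace IsRadiusField

variable {r₀ r₁ : ℝ} {δ : ℝ≥0} {r : Space n → ℝ}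

theorem lipschitzWith_spherePoint (hr : IsRadiusField r₀ r₁ δ r) {v : Space n} (hv : ‖v‖ = 1) :
    LipschitzWith (1 + δ) (spherePoint r v) := by
  have h1 : LipschitzWith δ fun c => r c • v := by
    refine LipschitzWith.of_dist_le_mul fun x y => ?_
    rw [dist_eq_norm, ← sub_smul, norm_smul, hv, mul_one, ← dist_eq_norm]
    exact hr.lipschitz.dist_le_mul x y
  exact LipschitzWith.id.add h1

theorem antilipschitzWith_spherePoint (hr : IsRadiusField r₀ r₁ δ r) {v : Space n}
    (hv : ‖v‖ = 1) : AntilipschitzWith (1 - δ)⁻¹ (spherePoint r v) := by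
  refine AntilipschitzWith.of_le_mul_dist fun x y => ?_
  have h1 : (0 : ℝ) < 1 - δ := by
    have := hr.lt_one
    have : (δ : ℝ) < 1 := by exact_mod_cast this
    linarith
  have h2 := hr.lipschitz.dist_le_mul x y
  have h3 : dist x y ≤ dist (spherePoint r v x) (spherePoint r v y) + dist (r x) (r y) := by
    have e : x - y = (spherePoint r v x - spherePoint r v y) - (r x - r y) • v := by
      simp only [spherePoint, sub_smul]; abel
    rw [dist_eq_norm x y, e]
    refine (norm_sub_le _ _).trans ?_
    rw [norm_smul, hv, mul_one, dist_eq_norm, dist_eq_norm]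
  rw [NNReal.coe_inv, NNReal.coe_sub hr.lt_one.le, NNReal.coe_one, inv_mul_eq_div, le_div_iff₀ h1]
  linarith

/-- Solve `t = r (x - t • v)` by the intermediate value theorem: `t - r (x - t • v)` is at most 0 at
`r₀` and at least 0 at `r₁`. -/
theorem surjective_spherePoint (hr : IsRadiusField r₀ r₁ δ r) (v : Space n) :
    Function.Surjective (spherePoint r v) := by
  intro x
  have hc : ContinuousOn (fun t : ℝ => t - r (x - t • v)) (Icc r₀ r₁) := by
    have := hr.lipschitz.continuous
    fun_prop
  have hle : r₀ ≤ r₁ := (hr.mem_Icc x).1.trans (hr.mem_Icc x).2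
  obtain ⟨t, -, ht⟩ := intermediate_value_Icc hle hc (show (0 : ℝ) ∈ _ from
    ⟨by linarith [(hr.mem_Icc (x - r₀ • v)).1], by linarith [(hr.mem_Icc (x - r₁ • v)).2]⟩)
  refine ⟨x - t • v, ?_⟩
  have : r (x - t • v) = t := by simp only at ht; linarith
  rw [spherePoint, this, sub_add_cancel]

theorem measurableEmbedding_spherePoint (hr : IsRadiusField r₀ r₁ δ r) {v : Space n}
    (hv : ‖v‖ = 1) : MeasurableEmbedding (spherePoint r v) :=
  (hr.lipschitzWith_spherePoint hv).continuous.measurableEmbedding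
    (hr.antilipschitzWith_spherePoint hv).injective

/-- By surjectivity each set is the image of its preimage, and a map with Lipschitz constant `1 + δ`
enlarges volume by at most `(1 + δ)ⁿ`. No differentiability of the radius is needed. -/
theorem volume_le_map (hr : IsRadiusField r₀ r₁ δ r) {v : Space n} (hv : ‖v‖ = 1) :
    (volume : Measure (Space n)) ≤
      ((1 + δ : ℝ≥0) : ℝ≥0∞) ^ n • volume.map (spherePoint r v) := by
  refine Measure.le_iff.2 fun A hA => ?_
  rw [Measure.smul_apply, (hr.measurableEmbedding_spherePoint hv).map_apply, smul_eq_mul]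
  have h := euclideanHausdorffMeasure_image_le n
    ((hr.lipschitzWith_spherePoint hv).lipschitzOnWith (s := spherePoint r v ⁻¹' A))
  rw [EuclideanSpace.euclideanHausdorffMeasure_eq_volume,
    image_preimage_eq _ (hr.surjective_spherePoint v)] at h
  exact h

/-- The centre of the sphere of the family that has `x` as its point in direction `v`. -/
noncomputable def centre (hr : IsRadiusField r₀ r₁ δ r) (v : Space n) : Space n → Space n :=
  Function.surjInv (hr.surjective_spherePoint v)

theorem spherePoint_centre (hr : IsRadiusField r₀ r₁ δ r) (v x : Space n) :
    spherePoint r v (hr.centre v x) = x := Function.surjInv_eq _ x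

theorem centre_spherePoint (hr : IsRadiusField r₀ r₁ δ r) {v : Space n} (hv : ‖v‖ = 1)
    (c : Space n) : hr.centre v (spherePoint r v c) = c :=
  (hr.antilipschitzWith_spherePoint hv).injective (hr.spherePoint_centre v _)

theorem continuous_centre (hr : IsRadiusField r₀ r₁ δ r) {v : Space n} (hv : ‖v‖ = 1) :
    Continuous (hr.centre v) :=
  ((hr.antilipschitzWith_spherePoint hv).to_rightInverse (hr.spherePoint_centre v)).continuous

theorem lintegral_centre_le (hr : IsRadiusField r₀ r₁ δ r) {v : Space n} (hv : ‖v‖ = 1)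
    (W g : Space n → ℝ≥0∞) :
    ∫⁻ x, W (hr.centre v x) * g x ≤
      ((1 + δ : ℝ≥0) : ℝ≥0∞) ^ n * ∫⁻ c, W c * g (spherePoint r v c) := by
  refine (lintegral_mono' (hr.volume_le_map hv) le_rfl).trans ?_
  rw [lintegral_smul_measure, (hr.measurableEmbedding_spherePoint hv).lintegral_map, smul_eq_mul]
  simp only [hr.centre_spherePoint hv]
  exact le_rfl

end IsRadiusField

/-! ### The weight on centres and its convexity along chords. -/

/-- The weight on centres: convex near the sphere of radius `R`, up to a slowly varying factor. -/
noncomputable def weight (R ε : ℝ) (c : Space n) : ℝ :=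
  max (‖c‖ - R) 0 * ((1 + ε * ‖c‖) ^ (n + 2))⁻¹

theorem weight_nonneg (R : ℝ) {ε : ℝ} (hε : 0 ≤ ε) (c : Space n) : 0 ≤ weight R ε c := by
  unfold weight
  positivity

theorem weight_pos {R ε : ℝ} (hε : 0 ≤ ε) {c : Space n} (hc : R < ‖c‖) : 0 < weight R ε c := by
  unfold weight
  have : 0 < max (‖c‖ - R) 0 := lt_max_of_lt_left (sub_pos.2 hc)
  positivity

theorem measurable_weight (R ε : ℝ) : Measurable (weight (n := n) R ε) := by
  unfold weight
  fun_prop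

/-- The exponent `n + 2` compensates the linear growth of the convex factor and leaves the
integrable decay `‖c‖ ^ (-(n + 1))`. -/
theorem lintegral_weight_lt_top {R ε : ℝ} (hR : 0 ≤ R) (hε : 0 < ε) (hε1 : ε ≤ 1) :
    ∫⁻ c : Space n, ENNReal.ofReal (weight R ε c) < ⊤ := by
  have h := finite_integral_one_add_norm (E := Space n) (μ := volume) (r := (n : ℝ) + 1)
    (by simp)
  have hb : ∀ c : Space n, ENNReal.ofReal (weight R ε c) ≤
      ENNReal.ofReal ((ε ^ (n + 2))⁻¹) * ENNReal.ofReal ((1 + ‖c‖) ^ (-((n : ℝ) + 1))) := by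
    intro c
    rw [← ENNReal.ofReal_mul (by positivity)]
    refine ENNReal.ofReal_le_ofReal ?_
    have h1 : 0 < 1 + ‖c‖ := by positivity
    have e1 : (1 + ‖c‖) ^ (-((n : ℝ) + 1)) = ((1 + ‖c‖) ^ (n + 1))⁻¹ := by
      rw [Real.rpow_neg h1.le]
      congr 1
      exact_mod_cast Real.rpow_natCast (1 + ‖c‖) (n + 1)
    rw [e1]
    have h2 : max (‖c‖ - R) 0 ≤ 1 + ‖c‖ := max_le (by linarith) h1.le
    have h3 : ε * (1 + ‖c‖) ≤ 1 + ε * ‖c‖ := by linarith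
    calc weight R ε c ≤ (1 + ‖c‖) * ((ε * (1 + ‖c‖)) ^ (n + 2))⁻¹ := by
          unfold weight
          gcongr
      _ = _ := by
          rw [mul_pow, pow_succ (1 + ‖c‖) (n + 1)]
          field_simp
  refine (lintegral_mono hb).trans_lt ?_
  rw [lintegral_const_mul' _ _ ENNReal.ofReal_ne_top]
  exact ENNReal.mul_lt_top ENNReal.ofReal_lt_top h

theorem inv_pow_le_of_dist_le {ε D : ℝ} (hε : 0 ≤ ε) (hD : 0 ≤ D) (k : ℕ) {x y : Space n}
    (hxy : dist x y ≤ D) :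
    ((1 + ε * ‖x‖) ^ k)⁻¹ ≤ (1 + ε * D) ^ k * ((1 + ε * ‖y‖) ^ k)⁻¹ := by
  have h1 : ‖y‖ ≤ ‖x‖ + D := by
    have := norm_sub_norm_le y x
    rw [← dist_eq_norm, dist_comm] at this
    linarith
  have h2 : 1 + ε * ‖y‖ ≤ (1 + ε * D) * (1 + ε * ‖x‖) := by
    have : 0 ≤ ε * D * (ε * ‖x‖) := by positivity
    nlinarith [mul_le_mul_of_nonneg_left h1 hε]
  rw [← div_eq_mul_inv, inv_eq_one_div, div_le_div_iff₀ (by positivity) (by positivity), one_mul,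
    ← mul_pow]
  gcongr

/-- The point `x - t • v` lies on the segment between the centres whose spheres pass through `x` in
directions `v` and `-v`. The convex factor is therefore bounded by its chord, while the decaying
factor changes by a bounded ratio over distances up to `2 r₁`. The coefficients `r₁ ± t` are chosen
so that the sum with the bound for `-v` no longer depends on `t`. -/
theorem IsRadiusField.weight_le {r₀ r₁ : ℝ} {δ : ℝ≥0} {r : Space n → ℝ}
    (hr : IsRadiusField r₀ r₁ δ r) {v : Space n} (hv : ‖v‖ = 1) (R : ℝ) {ε : ℝ} (hε : 0 ≤ ε)
    {x : Space n} {t : ℝ} (ht : 0 < t) (htr : t < r (x - t • v)) :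
    weight R ε (x - t • v) ≤ (1 + ε * (2 * r₁)) ^ (n + 2) / (2 * r₀) *
      ((r₁ + t) * weight R ε (hr.centre v x) + (r₁ - t) * weight R ε (hr.centre (-v) x)) := by
  set c₁ := hr.centre v x with hc₁
  set c₂ := hr.centre (-v) x with hc₂
  set ρ₁ := r c₁ with hρ₁
  set ρ₂ := r c₂ with hρ₂
  have e1 : c₁ = x - ρ₁ • v := by
    have := hr.spherePoint_centre v x
    rw [spherePoint] at this
    exact eq_sub_of_add_eq this
  have e2 : c₂ = x + ρ₂ • v := by
    have := hr.spherePoint_centre (-v) x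
    rw [spherePoint, smul_neg, ← sub_eq_add_neg] at this
    exact eq_add_of_sub_eq this
  have b1 := hr.mem_Icc c₁
  have b2 := hr.mem_Icc c₂
  have hr0 := hr.pos
  rw [← hρ₁] at b1
  rw [← hρ₂] at b2
  have hδ : (δ : ℝ) < 1 := by exact_mod_cast hr.lt_one
  -- As `δ < 1`, `t - r (x - t • v)` is strictly increasing in `t`, and it vanishes at `ρ₁`.
  have htρ : t < ρ₁ := by
    by_contra! hcon
    have h1 := hr.lipschitz.dist_le_mul (x - t • v) c₁
    have h2 : dist (x - t • v) c₁ = t - ρ₁ := by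
      rw [e1, dist_eq_norm, sub_sub_sub_cancel_left, ← sub_smul, norm_smul, hv, mul_one,
        Real.norm_eq_abs, abs_sub_comm, abs_of_nonneg (by linarith)]
    rw [h2, Real.dist_eq] at h1
    have h3 := (le_abs_self _).trans h1
    nlinarith
  have hsum : 0 < ρ₁ + ρ₂ := by linarith [b1.1, b2.1]
  have d1 : dist (x - t • v) c₁ ≤ 2 * r₁ := by
    rw [e1, dist_eq_norm, sub_sub_sub_cancel_left, ← sub_smul, norm_smul, hv, mul_one,
      Real.norm_eq_abs, abs_of_nonneg (by linarith)]
    linarith [b1.2, b2.1, b2.2]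
  have d2 : dist (x - t • v) c₂ ≤ 2 * r₁ := by
    have : x - t • v - (x + ρ₂ • v) = -((t + ρ₂) • v) := by rw [add_smul]; abel
    rw [e2, dist_eq_norm, this, norm_neg, norm_smul, hv, mul_one,
      Real.norm_eq_abs, abs_of_nonneg (by linarith [b2.1])]
    linarith [b1.2, b2.2]
  set p : Space n → ℝ := fun c => max (‖c‖ - R) 0 with hp
  have hp0 : ∀ c, 0 ≤ p c := fun c => le_max_right _ _
  have hchord : (ρ₁ + ρ₂) * p (x - t • v) ≤ (t + ρ₂) * p c₁ + (ρ₁ - t) * p c₂ := by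
    have ha : 0 ≤ t + ρ₂ := by linarith [b2.1]
    have hb : 0 ≤ ρ₁ - t := by linarith
    have hrhs : 0 ≤ (t + ρ₂) * p c₁ + (ρ₁ - t) * p c₂ :=
      add_nonneg (mul_nonneg ha (hp0 _)) (mul_nonneg hb (hp0 _))
    rcases le_total (‖x - t • v‖ - R) 0 with h | h
    · rw [show p (x - t • v) = 0 from max_eq_right h, mul_zero]; exact hrhs
    · rw [show p (x - t • v) = _ from max_eq_left h]
      have hcomb : (ρ₁ + ρ₂) • (x - t • v) = (t + ρ₂) • c₁ + (ρ₁ - t) • c₂ := by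
        rw [e1, e2]; module
      have hn := norm_add_le ((t + ρ₂) • c₁) ((ρ₁ - t) • c₂)
      rw [← hcomb, norm_smul, norm_smul, norm_smul, Real.norm_of_nonneg hsum.le,
        Real.norm_of_nonneg ha, Real.norm_of_nonneg hb] at hn
      have h1 := mul_le_mul_of_nonneg_left (le_max_left (‖c₁‖ - R) 0) ha
      have h2 := mul_le_mul_of_nonneg_left (le_max_left (‖c₂‖ - R) 0) hb
      simp only [hp]
      linarith
  have hD : 0 ≤ 2 * r₁ := by linarith [b1.1, b1.2]
  have q1 := inv_pow_le_of_dist_le hε hD (n + 2) d1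
  have q2 := inv_pow_le_of_dist_le hε hD (n + 2) d2
  set q : Space n → ℝ := fun c => ((1 + ε * ‖c‖) ^ (n + 2))⁻¹ with hq
  have hq0 : ∀ c, 0 ≤ q c := fun c => by simp only [hq]; positivity
  set M := (1 + ε * (2 * r₁)) ^ (n + 2) with hM
  have hM0 : 0 ≤ M := by positivity
  have hmain : (ρ₁ + ρ₂) * (p (x - t • v) * q (x - t • v)) ≤
      M * ((r₁ + t) * (p c₁ * q c₁) + (r₁ - t) * (p c₂ * q c₂)) := by
    calc (ρ₁ + ρ₂) * (p (x - t • v) * q (x - t • v))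
        = ((ρ₁ + ρ₂) * p (x - t • v)) * q (x - t • v) := by ring
      _ ≤ ((t + ρ₂) * p c₁ + (ρ₁ - t) * p c₂) * q (x - t • v) :=
          mul_le_mul_of_nonneg_right hchord (hq0 _)
      _ = (t + ρ₂) * p c₁ * q (x - t • v) + (ρ₁ - t) * p c₂ * q (x - t • v) := by ring
      _ ≤ (r₁ + t) * p c₁ * (M * q c₁) + (r₁ - t) * p c₂ * (M * q c₂) := by
          have h1 := hp0 c₁
          have h2 := hp0 c₂
          have h3 := hq0 (x - t • v)
          have h4 : 0 ≤ r₁ + t := by linarith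
          have h5 : 0 ≤ r₁ - t := by linarith [b1.2]
          gcongr ?_ * _ * ?_ + ?_ * _ * ?_
          · linarith [b2.2]
          · linarith [b1.2]
      _ = _ := by ring
  show p (x - t • v) * q (x - t • v) ≤ M / (2 * r₀) *
      ((r₁ + t) * (p c₁ * q c₁) + (r₁ - t) * (p c₂ * q c₂))
  have h6 : 2 * r₀ * (p (x - t • v) * q (x - t • v)) ≤
      (ρ₁ + ρ₂) * (p (x - t • v) * q (x - t • v)) :=
    mul_le_mul_of_nonneg_right (by linarith [b1.1, b2.1]) (mul_nonneg (hp0 _) (hq0 _))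
  rw [div_mul_eq_mul_div, le_div_iff₀ (by linarith)]
  linarith

/-! ### Averaged ball integrals against averaged sphere integrals. -/

theorem measurePreserving_neg_dir :
    MeasurePreserving (fun θ : Dir n => -θ) (volume : Measure (Space n)).toSphere
      (volume : Measure (Space n)).toSphere := by
  refine ⟨measurable_neg, Measure.ext fun A hA => ?_⟩
  rw [Measure.map_apply measurable_neg hA, Measure.toSphere_apply' _ hA,
    Measure.toSphere_apply' _ (measurable_neg hA)]
  congr 1
  rw [← Measure.measure_neg volume (Ioo (0 : ℝ) 1 • (Subtype.val '' A : Set (Space n)))]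
  congr 1
  ext x
  simp only [Set.mem_smul, Set.mem_neg, mem_image, mem_preimage]
  constructor
  · rintro ⟨t, ht, _, ⟨θ, hθ, rfl⟩, rfl⟩
    exact ⟨t, ht, _, ⟨-θ, hθ, rfl⟩, by simp⟩
  · rintro ⟨t, ht, _, ⟨θ, hθ, rfl⟩, hx⟩
    refine ⟨t, ht, _, ⟨-θ, by simpa using hθ, rfl⟩, ?_⟩
    rw [← neg_eq_iff_eq_neg.2 hx]
    simp

theorem lintegral_dir_neg (F : Dir n → ℝ≥0∞) :
    ∫⁻ θ, F (-θ) ∂(volume : Measure (Space n)).toSphere =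
      ∫⁻ θ, F θ ∂(volume : Measure (Space n)).toSphere :=
  measurePreserving_neg_dir.lintegral_comp_emb (Homeomorph.neg (Dir n)).measurableEmbedding F

/-- The part of the integral of `g` over the ball of centre `c` and radius `r c` that lies in
direction `v`, in polar coordinates. -/
noncomputable def rayIntegral (r : Space n → ℝ) (g : Space n → ℝ≥0∞) (v c : Space n) : ℝ≥0∞ :=
  ∫⁻ t in Ioi (0 : ℝ), ENNReal.ofReal (t ^ (n - 1)) * (if t < r c then g (c + t • v) else 0)

namespace IsRadiusField

variable {r₀ r₁ : ℝ} {δ : ℝ≥0} {r : Space n → ℝ}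

/-- Tonelli and the translation `c = x - t • v`: the average over centres becomes an average of `g`
at a fixed point `x`, weighted by the centres whose balls contain `x` along the ray. -/
theorem lintegral_mul_rayIntegral (hr : IsRadiusField r₀ r₁ δ r) {W g : Space n → ℝ≥0∞}
    (hW : Measurable W) (hg : Measurable g) (v : Space n) :
    ∫⁻ c, W c * rayIntegral r g v c = ∫⁻ x, g x * ∫⁻ t in Ioi (0 : ℝ),
      ENNReal.ofReal (t ^ (n - 1)) * (if t < r (x - t • v) then W (x - t • v) else 0) := by
  have hrm := hr.lipschitz.continuous.measurable
  have hm : Measurable fun p : Space n × ℝ =>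
      ENNReal.ofReal (p.2 ^ (n - 1)) * (if p.2 < r p.1 then g (p.1 + p.2 • v) else 0) := by
    refine Measurable.mul (by fun_prop) (Measurable.ite ?_ (by fun_prop) measurable_const)
    exact measurableSet_lt measurable_snd (hrm.comp measurable_fst)
  have hm' : Measurable fun p : Space n × ℝ => ENNReal.ofReal (p.2 ^ (n - 1)) *
      (if p.2 < r (p.1 - p.2 • v) then W (p.1 - p.2 • v) else 0) := by
    refine Measurable.mul (by fun_prop) (Measurable.ite ?_ (by fun_prop) measurable_const)
    exact measurableSet_lt measurable_snd (hrm.comp (by fun_prop))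
  calc ∫⁻ c, W c * rayIntegral r g v c
      = ∫⁻ c, ∫⁻ t in Ioi (0 : ℝ), W c *
          (ENNReal.ofReal (t ^ (n - 1)) * (if t < r c then g (c + t • v) else 0)) := by
        refine lintegral_congr fun c => ?_
        exact (lintegral_const_mul _ (hm.comp measurable_prodMk_left)).symm
    _ = ∫⁻ t in Ioi (0 : ℝ), ∫⁻ c, W c *
          (ENNReal.ofReal (t ^ (n - 1)) * (if t < r c then g (c + t • v) else 0)) :=
        lintegral_lintegral_swap ((hW.comp measurable_fst).mul hm).aemeasurable
    _ = ∫⁻ t in Ioi (0 : ℝ), ∫⁻ x, g x * (ENNReal.ofReal (t ^ (n - 1)) *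
          (if t < r (x - t • v) then W (x - t • v) else 0)) := by
        refine lintegral_congr fun t => ?_
        rw [← lintegral_sub_right_eq_self _ (t • v)]
        refine lintegral_congr fun x => ?_
        rw [sub_add_cancel]
        split_ifs
        · ring
        · simp
    _ = ∫⁻ x, ∫⁻ t in Ioi (0 : ℝ), g x * (ENNReal.ofReal (t ^ (n - 1)) *
          (if t < r (x - t • v) then W (x - t • v) else 0)) :=
        (lintegral_lintegral_swap ((hg.comp measurable_fst).mul hm').aemeasurable).symm
    _ = _ := by
        refine lintegral_congr fun x => ?_
        exact lintegral_const_mul _ (hm'.comp measurable_prodMk_left)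

/-- Opposite directions are added because the chord coefficients then sum to `2 r₁` for both
endpoints, and only the integral of `t ^ (n - 1)` over `(0, r₁]`, equal to `r₁ⁿ / n`, remains. -/
theorem lintegral_weight_le (hn : 1 ≤ n) (hr : IsRadiusField r₀ r₁ δ r) {v : Space n}
    (hv : ‖v‖ = 1) (R : ℝ) {ε : ℝ} (hε : 0 ≤ ε) (x : Space n) :
    (∫⁻ t in Ioi (0 : ℝ), ENNReal.ofReal (t ^ (n - 1)) *
        (if t < r (x - t • v) then ENNReal.ofReal (weight R ε (x - t • v)) else 0)) +
      (∫⁻ t in Ioi (0 : ℝ), ENNReal.ofReal (t ^ (n - 1)) *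
        (if t < r (x - t • -v) then ENNReal.ofReal (weight R ε (x - t • -v)) else 0)) ≤
    ENNReal.ofReal ((1 + ε * (2 * r₁)) ^ (n + 2) * (r₁ / r₀) * (r₁ ^ n / n)) *
      (ENNReal.ofReal (weight R ε (hr.centre v x)) +
        ENNReal.ofReal (weight R ε (hr.centre (-v) x))) := by
  set a := weight R ε (hr.centre v x) with ha
  set b := weight R ε (hr.centre (-v) x) with hb
  have ha0 : 0 ≤ a := weight_nonneg R hε _
  have hb0 : 0 ≤ b := weight_nonneg R hε _
  set M := (1 + ε * (2 * r₁)) ^ (n + 2) / (2 * r₀) with hM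
  have hr0 := hr.pos
  have hr1 : 0 < r₁ := hr0.trans_le ((hr.mem_Icc x).1.trans (hr.mem_Icc x).2)
  have hM0 : 0 ≤ M := by positivity
  have hrm := hr.lipschitz.continuous.measurable
  have hm' : Measurable fun t : ℝ => ENNReal.ofReal (t ^ (n - 1)) *
      (if t < r (x - t • v) then ENNReal.ofReal (weight R ε (x - t • v)) else 0) := by
    have := measurable_weight (n := n) R ε
    refine Measurable.mul (by fun_prop) (Measurable.ite ?_ (by fun_prop) measurable_const)
    exact measurableSet_lt measurable_id (hrm.comp (by fun_prop))
  have hbound : ∀ (w : Space n), ‖w‖ = 1 → ∀ t ∈ Ioi (0 : ℝ),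
      (if t < r (x - t • w) then ENNReal.ofReal (weight R ε (x - t • w)) else 0) ≤
      (Ioc 0 r₁).indicator (fun t => ENNReal.ofReal (M * ((r₁ + t) * weight R ε (hr.centre w x) +
        (r₁ - t) * weight R ε (hr.centre (-w) x)))) t := by
    intro w hw t ht
    split_ifs with h
    · have : t ∈ Ioc 0 r₁ := ⟨ht, h.le.trans (hr.mem_Icc _).2⟩
      rw [indicator_of_mem this]
      exact ENNReal.ofReal_le_ofReal (hr.weight_le hw R hε ht h)
    · exact zero_le
  have hv' : ‖-v‖ = 1 := by rwa [norm_neg]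
  rw [← lintegral_add_left hm']
  calc _ ≤ ∫⁻ t in Ioi (0 : ℝ), (Ioc 0 r₁).indicator (fun t => ENNReal.ofReal (t ^ (n - 1)) *
            ENNReal.ofReal (M * (2 * r₁ * (a + b)))) t := by
        refine setLIntegral_mono' measurableSet_Ioi fun t ht => ?_
        have h1 := hbound v hv t ht
        have h2 := hbound (-v) hv' t ht
        rw [neg_neg, ← ha, ← hb] at *
        rw [← mul_add]
        by_cases hm : t ∈ Ioc 0 r₁
        · rw [indicator_of_mem hm] at h1 h2 ⊢
          gcongr
          refine (add_le_add h1 h2).trans (le_of_eq ?_)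
          have h3 : 0 ≤ r₁ - t := by linarith [hm.2]
          have h4 : 0 ≤ r₁ + t := by linarith [hm.1]
          rw [← ENNReal.ofReal_add (by positivity) (by positivity)]
          congr 1
          ring
        · rw [indicator_of_notMem hm] at h1 h2 ⊢
          rw [nonpos_iff_eq_zero.1 h1, nonpos_iff_eq_zero.1 h2]
          simp
    _ = (∫⁻ t in Ioc (0 : ℝ) r₁, ENNReal.ofReal (t ^ (n - 1))) *
          ENNReal.ofReal (M * (2 * r₁ * (a + b))) := by
        rw [lintegral_indicator measurableSet_Ioc, Measure.restrict_restrict measurableSet_Ioc,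
          inter_eq_left.2 Ioc_subset_Ioi_self, lintegral_mul_const _ (by fun_prop)]
    _ = ENNReal.ofReal (r₁ ^ n / n) * ENNReal.ofReal (M * (2 * r₁ * (a + b))) := by
        congr 1
        rw [← ofReal_integral_eq_lintegral_ofReal, ← intervalIntegral.integral_of_le hr1.le,
          integral_pow]
        · rw [Nat.sub_add_cancel hn, Nat.cast_sub hn]
          simp [zero_pow (by omega : n ≠ 0)]
        · exact (intervalIntegral.intervalIntegrable_pow _).1
        · filter_upwards [ae_restrict_mem measurableSet_Ioc] with y hy
          exact pow_nonneg hy.1.le _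
    _ = _ := by
        rw [← ENNReal.ofReal_add ha0 hb0, ← ENNReal.ofReal_mul (by positivity),
          ← ENNReal.ofReal_mul (by positivity)]
        congr 1
        rw [hM]
        field_simp

theorem lintegral_rayIntegral_le (hn : 1 ≤ n) (hr : IsRadiusField r₀ r₁ δ r)
    {g : Space n → ℝ≥0∞} (hg : Measurable g) {v : Space n} (hv : ‖v‖ = 1) (R : ℝ) {ε : ℝ}
    (hε : 0 ≤ ε) :
    (∫⁻ c, ENNReal.ofReal (weight R ε c) * rayIntegral r g v c) +
      (∫⁻ c, ENNReal.ofReal (weight R ε c) * rayIntegral r g (-v) c) ≤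
    ENNReal.ofReal ((1 + ε * (2 * r₁)) ^ (n + 2) * (r₁ / r₀) * (r₁ ^ n / n)) *
      ((1 + δ : ℝ≥0) : ℝ≥0∞) ^ n *
      ((∫⁻ c, ENNReal.ofReal (weight R ε c) * g (spherePoint r v c)) +
        ∫⁻ c, ENNReal.ofReal (weight R ε c) * g (spherePoint r (-v) c)) := by
  have hv' : ‖-v‖ = 1 := by rwa [norm_neg]
  have hwm : Measurable fun c : Space n => ENNReal.ofReal (weight R ε c) :=
    (measurable_weight R ε).ennreal_ofReal
  have hrm := hr.lipschitz.continuous.measurable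
  have hS := (hr.continuous_centre hv).measurable
  have hm' : Measurable fun p : Space n × ℝ => ENNReal.ofReal (p.2 ^ (n - 1)) *
      (if p.2 < r (p.1 - p.2 • v) then ENNReal.ofReal (weight R ε (p.1 - p.2 • v)) else 0) := by
    have := measurable_weight (n := n) R ε
    refine Measurable.mul (by fun_prop) (Measurable.ite ?_ (by fun_prop) measurable_const)
    exact measurableSet_lt measurable_snd (hrm.comp (by fun_prop))
  have hm'' : Measurable fun x => g x * ∫⁻ t in Ioi (0 : ℝ), ENNReal.ofReal (t ^ (n - 1)) *
      (if t < r (x - t • v) then ENNReal.ofReal (weight R ε (x - t • v)) else 0) :=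
    hg.mul hm'.lintegral_prod_right'
  rw [hr.lintegral_mul_rayIntegral hwm hg, hr.lintegral_mul_rayIntegral hwm hg,
    ← lintegral_add_left hm'']
  calc _ ≤ ∫⁻ x, g x * (ENNReal.ofReal ((1 + ε * (2 * r₁)) ^ (n + 2) * (r₁ / r₀) * (r₁ ^ n / n)) *
          (ENNReal.ofReal (weight R ε (hr.centre v x)) +
            ENNReal.ofReal (weight R ε (hr.centre (-v) x)))) := by
        refine lintegral_mono fun x => ?_
        rw [← mul_add]
        gcongr
        exact hr.lintegral_weight_le hn hv R hε x
    _ = ENNReal.ofReal ((1 + ε * (2 * r₁)) ^ (n + 2) * (r₁ / r₀) * (r₁ ^ n / n)) *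
          ((∫⁻ x, ENNReal.ofReal (weight R ε (hr.centre v x)) * g x) +
            ∫⁻ x, ENNReal.ofReal (weight R ε (hr.centre (-v) x)) * g x) := by
        have h1 : Measurable fun x => ENNReal.ofReal (weight R ε (hr.centre v x)) * g x :=
          (hwm.comp hS).mul hg
        rw [← lintegral_add_left h1, ← lintegral_const_mul' _ _ ENNReal.ofReal_ne_top]
        exact lintegral_congr fun x => by ring
    _ ≤ _ := by
        rw [mul_assoc (ENNReal.ofReal _) (_ ^ n), mul_add (_ ^ n)]
        gcongr
        · exact hr.lintegral_centre_le hv _ g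
        · exact hr.lintegral_centre_le hv' _ g

/-- The bound for a pair of opposite directions is integrated over the sphere; invariance under `θ ↦
-θ` turns each pair into twice one term, and the factor 2 cancels. -/
theorem lintegral_lintegral_rayIntegral_le (hn : 1 ≤ n) (hr : IsRadiusField r₀ r₁ δ r)
    {g : Space n → ℝ≥0∞} (hg : Measurable g) (R : ℝ) {ε : ℝ} (hε : 0 ≤ ε) :
    ∫⁻ θ : Dir n, ∫⁻ c, ENNReal.ofReal (weight R ε c) * rayIntegral r g θ c
      ∂volume ∂(volume : Measure (Space n)).toSphere ≤
    ENNReal.ofReal ((1 + ε * (2 * r₁)) ^ (n + 2) * (r₁ / r₀) * (r₁ ^ n / n)) *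
      ((1 + δ : ℝ≥0) : ℝ≥0∞) ^ n *
      ∫⁻ θ : Dir n, ∫⁻ c, ENNReal.ofReal (weight R ε c) * g (spherePoint r θ c)
        ∂volume ∂(volume : Measure (Space n)).toSphere := by
  set I : Dir n → ℝ≥0∞ := fun θ => ∫⁻ c, ENNReal.ofReal (weight R ε c) * rayIntegral r g θ c
  set J : Dir n → ℝ≥0∞ := fun θ => ∫⁻ c, ENNReal.ofReal (weight R ε c) * g (spherePoint r θ c)
  set K := ENNReal.ofReal ((1 + ε * (2 * r₁)) ^ (n + 2) * (r₁ / r₀) * (r₁ ^ n / n)) *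
      ((1 + δ : ℝ≥0) : ℝ≥0∞) ^ n
  have hK : K ≠ ⊤ := ENNReal.mul_ne_top ENNReal.ofReal_ne_top (ENNReal.pow_ne_top (by simp))
  have hrm := hr.lipschitz.continuous.measurable
  have hwm : Measurable fun c : Space n => ENNReal.ofReal (weight R ε c) :=
    (measurable_weight R ε).ennreal_ofReal
  have hIm : Measurable I := by
    have h1 : Measurable fun q : (Dir n × Space n) × ℝ => ENNReal.ofReal (q.2 ^ (n - 1)) *
        (if q.2 < r q.1.2 then g (q.1.2 + q.2 • (q.1.1 : Space n)) else 0) := by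
      refine Measurable.mul (by fun_prop) (Measurable.ite ?_ (by fun_prop) measurable_const)
      exact measurableSet_lt measurable_snd (hrm.comp (by fun_prop))
    have h2 : Measurable fun p : Dir n × Space n => rayIntegral r g p.1 p.2 :=
      h1.lintegral_prod_right'
    exact ((hwm.comp measurable_snd).mul h2).lintegral_prod_right'
  have hJm : Measurable J := by
    have h2 : Measurable fun p : Dir n × Space n => g (spherePoint r p.1 p.2) := by
      unfold spherePoint
      fun_prop
    exact ((hwm.comp measurable_snd).mul h2).lintegral_prod_right'
  have h1 : ∫⁻ θ, (I θ + I (-θ)) ∂(volume : Measure (Space n)).toSphere ≤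
      ∫⁻ θ, K * (J θ + J (-θ)) ∂(volume : Measure (Space n)).toSphere :=
    lintegral_mono fun θ => hr.lintegral_rayIntegral_le hn hg (norm_dir θ) R hε
  rw [lintegral_add_left hIm, lintegral_dir_neg I, lintegral_const_mul' _ _ hK,
    lintegral_add_left hJm, lintegral_dir_neg J, ← two_mul, ← two_mul, mul_left_comm] at h1
  exact (ENNReal.mul_le_mul_iff_right (by simp) (by simp)).1 h1

end IsRadiusField

/-! ### Vanishing near infinity from the averaged inequality. -/

namespace IsRadiusField

variable {r₀ r₁ : ℝ} {δ : ℝ≥0} {r : Space n → ℝ}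

/-- If the spherical integrals of `G` are controlled, with a small constant, by the integrals over
the balls of a minorant of `G`, then `G` vanishes near infinity. -/
theorem ae_eq_zero_of_forall_le (hn : 1 ≤ n) (hr : IsRadiusField r₀ r₁ δ r)
    {g : Space n → ℝ≥0∞} (hg : Measurable g) {G : Space n × Dir n → ℝ≥0∞} (hG : Measurable G)
    (hgG : ∀ x θ, g x ≤ G (x, θ)) (hG1 : ∀ p, G p ≤ 1) {R ε : ℝ} (hR : 0 ≤ R) (hε : 0 < ε)
    (hε1 : ε ≤ 1) {Λ : ℝ≥0∞}
    (hΛ : Λ * (ENNReal.ofReal ((1 + ε * (2 * r₁)) ^ (n + 2) * (r₁ / r₀) * (r₁ ^ n / n)) *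
      ((1 + δ : ℝ≥0) : ℝ≥0∞) ^ n) < 1)
    (hle : ∀ c : Space n, R < ‖c‖ →
      ∫⁻ θ : Dir n, G (spherePoint r θ c, θ) ∂(volume : Measure (Space n)).toSphere ≤
      Λ * ∫⁻ θ : Dir n, rayIntegral r g θ c ∂(volume : Measure (Space n)).toSphere) :
    ∀ᵐ p ∂(spaceDirMeasure n), R + r₁ < ‖p.1‖ → G p = 0 := by
  set σ := (volume : Measure (Space n)).toSphere
  set W : Space n → ℝ≥0∞ := fun c => ENNReal.ofReal (weight R ε c) with hW
  set K := ENNReal.ofReal ((1 + ε * (2 * r₁)) ^ (n + 2) * (r₁ / r₀) * (r₁ ^ n / n)) *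
      ((1 + δ : ℝ≥0) : ℝ≥0∞) ^ n with hK
  have hrm := hr.lipschitz.continuous.measurable
  have hwm : Measurable W := (measurable_weight R ε).ennreal_ofReal
  have hGm : Measurable fun p : Dir n × Space n => G (spherePoint r p.1 p.2, p.1) := by
    unfold spherePoint
    fun_prop
  have hRm : Measurable fun p : Dir n × Space n => rayIntegral r g p.1 p.2 := by
    have h1 : Measurable fun q : (Dir n × Space n) × ℝ => ENNReal.ofReal (q.2 ^ (n - 1)) *
        (if q.2 < r q.1.2 then g (q.1.2 + q.2 • (q.1.1 : Space n)) else 0) := by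
      refine Measurable.mul (by fun_prop) (Measurable.ite ?_ (by fun_prop) measurable_const)
      exact measurableSet_lt measurable_snd (hrm.comp (by fun_prop))
    exact h1.lintegral_prod_right'
  have hWG : Measurable fun p : Dir n × Space n => W p.2 * G (spherePoint r p.1 p.2, p.1) :=
    (hwm.comp measurable_snd).mul hGm
  set L := ∫⁻ θ, ∫⁻ c, W c * G (spherePoint r θ c, θ) ∂volume ∂σ with hL
  have hLtop : L ≠ ⊤ := by
    have : L ≤ ∫⁻ θ : Dir n, ∫⁻ c, W c ∂volume ∂σ :=
      lintegral_mono fun θ => lintegral_mono fun c => mul_le_of_le_one_right' (hG1 _)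
    refine (this.trans_lt ?_).ne
    rw [lintegral_const]
    exact ENNReal.mul_lt_top (lintegral_weight_lt_top hR hε hε1) (measure_lt_top _ _)
  have h1 : L ≤ Λ * ∫⁻ θ : Dir n, ∫⁻ c, W c * rayIntegral r g θ c ∂volume ∂σ := by
    have hsw : ∫⁻ θ : Dir n, ∫⁻ c, W c * rayIntegral r g θ c ∂volume ∂σ =
        ∫⁻ c, ∫⁻ θ : Dir n, W c * rayIntegral r g θ c ∂σ :=
      lintegral_lintegral_swap ((hwm.comp measurable_snd).mul hRm).aemeasurable
    rw [hL, lintegral_lintegral_swap hWG.aemeasurable, hsw]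
    have hI : Measurable fun c => ∫⁻ θ : Dir n, W c * rayIntegral r g θ c ∂σ :=
      ((hwm.comp measurable_snd).mul hRm).lintegral_prod_left'
    rw [← lintegral_const_mul _ hI]
    refine lintegral_mono fun c => ?_
    simp only
    rw [lintegral_const_mul' _ _ ENNReal.ofReal_ne_top,
      lintegral_const_mul' _ _ ENNReal.ofReal_ne_top, mul_left_comm]
    -- The hypothesis is available only for far centres; the weight vanishes at the others.
    by_cases hc : R < ‖c‖
    · gcongr
      exact hle c hc
    · have : ENNReal.ofReal (weight R ε c) = 0 := by
        rw [weight, max_eq_right (by linarith), zero_mul, ENNReal.ofReal_zero]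
      rw [this, zero_mul]
      exact zero_le
  have h2 : L ≤ Λ * K * L := by
    refine h1.trans ?_
    rw [mul_assoc]
    gcongr
    refine (hr.lintegral_lintegral_rayIntegral_le hn hg R hε.le).trans ?_
    gcongr
    refine lintegral_mono fun θ => lintegral_mono fun c => ?_
    exact mul_le_mul_right (hgG _ _) _
  -- Finiteness of `L`, guaranteed by the integrable weight, is what allows absorption.
  have hL0 : L = 0 := by
    by_contra hne
    have : Λ * K * L < 1 * L := ENNReal.mul_lt_mul_left hne hLtop hΛ
    rw [one_mul] at this
    exact absurd h2 (not_le.2 this)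
  have hmG : MeasurableSet {p : Space n × Dir n | R + r₁ < ‖p.1‖ → G p = 0} := by
    refine measurableSet_setOfPred.2 ?_
    have a1 : MeasurableSet {p : Space n × Dir n | R + r₁ < ‖p.1‖} :=
      measurableSet_lt measurable_const (by fun_prop)
    have a2 : MeasurableSet {p : Space n × Dir n | G p = 0} := hG (measurableSet_singleton 0)
    exact (measurableSet_setOfPred.1 a1).imp (measurableSet_setOfPred.1 a2)
  rw [spaceDirMeasure, Measure.ae_prod_iff_ae_ae hmG, Measure.ae_ae_comm hmG]
  rw [hL, lintegral_eq_zero_iff hWG.lintegral_prod_right'] at hL0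
  filter_upwards [hL0] with θ hθ
  have hθ' : ∫⁻ c, W c * G (spherePoint r θ c, θ) = 0 := hθ
  -- Back from centres to points `x` of the spheres. For `‖x‖ > R + r₁` the centre is farther than
  -- `R` from the origin, so its weight is positive and `G` itself must vanish.
  have h3 := hr.lintegral_centre_le (norm_dir θ) W fun x => G (x, θ)
  rw [hθ', mul_zero, nonpos_iff_eq_zero, lintegral_eq_zero_iff] at h3
  · filter_upwards [h3] with x hx hxR
    rcases mul_eq_zero.1 (show W (hr.centre θ x) * G (x, θ) = 0 from hx) with h | h
    · exfalso
      refine absurd h (ENNReal.ofReal_pos.2 (weight_pos hε.le ?_)).ne'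
      have h4 := hr.spherePoint_centre (θ : Space n) x
      have h5 : ‖x‖ ≤ ‖hr.centre θ x‖ + r (hr.centre θ x) := by
        conv_lhs => rw [← h4]
        refine (norm_add_le _ _).trans ?_
        rw [norm_smul, norm_dir, mul_one,
          Real.norm_of_nonneg (hr.pos.le.trans (hr.mem_Icc _).1)]
      linarith [(hr.mem_Icc (hr.centre θ x)).2]
    · exact h
  · exact (hwm.comp (hr.continuous_centre (norm_dir θ)).measurable).mul
      (hG.comp measurable_prodMk_right)

end IsRadiusField

/-! ### Mean density, existence of good balls, and the theorem. -/

theorem measurable_hPlus {f : Space n → ℝ≥0} {h : Space n × Dir n → ℝ≥0}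
    (hfh : IsDoubleDensity f h) : Measurable (hPlus h) := by
  refine LowerSemicontinuous.measurable ?_
  refine lowerSemicontinuous_iSup fun ν => ?_
  have h1 : LowerSemicontinuous fun x : Space n => h (x, ν) :=
    hfh.lsc_h.comp (g := fun x : Space n => (x, ν)) (by fun_prop)
  exact ENNReal.continuous_coe.comp_lowerSemicontinuous h1 ENNReal.coe_mono

/-- Conversion between a perimeter and the mean density it defines. -/
theorem exists_isMeanDensity (hn : 1 ≤ n) {f : Space n → ℝ≥0} {h : Space n × Dir n → ℝ≥0}
    {F : Set (Space n)} {m : ℝ} (hm : 0 < m) (hF : MeasurableSet F) (hFp : HasFinitePerimeter F)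
    (hvol : weightedVolume f F = ENNReal.ofReal m)
    (hper : weightedPerimeter h F ≤
      ENNReal.ofReal (n * omega n ^ (1 / (n : ℝ)) * m ^ (((n : ℝ) - 1) / n))) :
    ∃ ρ : ℝ≥0, IsMeanDensity f h F ρ ∧ ρ ≤ 1 ∧ (weightedPerimeter h F <
      ENNReal.ofReal (n * omega n ^ (1 / (n : ℝ)) * m ^ (((n : ℝ) - 1) / n)) → ρ < 1) := by
  have hω := omega_pos n
  have hn0 : (0 : ℝ) < n := by exact_mod_cast hn
  have hnn : n ≠ 0 := by omega
  set M := m ^ (((n : ℝ) - 1) / n) with hM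
  have hM0 : 0 < M := Real.rpow_pos_of_pos hm _
  have htop : weightedPerimeter h F ≠ ⊤ := (hper.trans_lt ENNReal.ofReal_lt_top).ne
  set P := (weightedPerimeter h F).toReal with hP
  have hP0 : 0 ≤ P := ENNReal.toReal_nonneg
  have hPe : weightedPerimeter h F = ENNReal.ofReal P := (ENNReal.ofReal_toReal htop).symm
  set q := P / (n * M) with hq
  have hq0 : 0 ≤ q := by positivity
  have hρ0 : 0 ≤ q ^ n / omega n := by positivity
  have hroot : (omega n ^ (1 / (n : ℝ))) ^ n = omega n := by
    rw [one_div, Real.rpow_inv_natCast_pow hω.le hnn]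
  refine ⟨Real.toNNReal (q ^ n / omega n), ⟨hF, hFp, ?_⟩, ?_, fun hlt => ?_⟩
  · rw [Real.coe_toNNReal _ hρ0, mul_div_cancel₀ _ hω.ne', one_div,
      Real.pow_rpow_inv_natCast hq0 hnn, hvol, ENNReal.ofReal_rpow_of_pos hm,
      ← ENNReal.ofReal_mul (by positivity), hPe, ← hM]
    congr 1
    rw [hq]; field_simp
  · rw [hPe, ENNReal.ofReal_le_ofReal_iff (by positivity)] at hper
    have h1 : q ≤ omega n ^ (1 / (n : ℝ)) := by
      rw [hq, div_le_iff₀ (by positivity)]; linarith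
    rw [Real.toNNReal_le_one, div_le_one hω, ← hroot]
    gcongr
  · rw [hPe, ENNReal.ofReal_lt_ofReal_iff (by positivity)] at hlt
    have h1 : q < omega n ^ (1 / (n : ℝ)) := by
      rw [hq, div_lt_iff₀ (by positivity)]; linarith
    rw [Real.toNNReal_lt_one, div_lt_one hω, ← hroot]
    gcongr

theorem isoperimetric_const_eq (hn : 1 ≤ n) {r m : ℝ} (hr : 0 < r) (hm : omega n * r ^ n = m) :
    n * omega n ^ (1 / (n : ℝ)) * m ^ (((n : ℝ) - 1) / n) = n * omega n * r ^ (n - 1) := by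
  have hω := omega_pos n
  have hn0 : (n : ℝ) ≠ 0 := by positivity
  have e1 : (r ^ n) ^ (((n : ℝ) - 1) / n) = r ^ (n - 1) := by
    rw [← Real.rpow_natCast r n, ← Real.rpow_mul hr.le, mul_div_cancel₀ _ hn0,
      ← Real.rpow_natCast r (n - 1), Nat.cast_sub hn, Nat.cast_one]
  rw [← hm, Real.mul_rpow hω.le (by positivity), e1, mul_assoc, ← mul_assoc (_ ^ _) (_ ^ _),
    ← Real.rpow_add hω, ← add_div, add_sub_cancel, div_self hn0, Real.rpow_one]
  ring

theorem toSphere_univ_eq : (volume : Measure (Space n)).toSphere univ =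
    ENNReal.ofReal (n * omega n) := by
  rw [Measure.toSphere_apply_univ, finrank_euclideanSpace, Fintype.card_fin,
    ENNReal.ofReal_mul (by positivity), ENNReal.ofReal_natCast, omega, measureReal_def,
    ENNReal.ofReal_toReal measure_ball_lt_top.ne]

/-- The deficit `1 - h` is kept on the left, since it is the quantity to be averaged. -/
theorem weightedPerimeter_ball_add_le (hn : 1 ≤ n) {h : Space n × Dir n → ℝ≥0}
    (hh : Measurable h) {c : Space n} {r : ℝ} (hr : 0 < r)
    (h1 : ∀ θ : Dir n, h (sphereMap c r θ, θ) ≤ 1) :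
    weightedPerimeter h (ball c r) + ENNReal.ofReal (r ^ (n - 1)) *
      ∫⁻ θ : Dir n, (1 - (h (sphereMap c r θ, θ) : ℝ≥0∞)) ∂(volume : Measure (Space n)).toSphere ≤
    ENNReal.ofReal (n * omega n * r ^ (n - 1)) := by
  have hmeas : Measurable fun θ : Dir n => (h (sphereMap c r θ, θ) : ℝ≥0∞) := by
    have := (continuous_sphereMap c r).measurable
    fun_prop
  refine (add_le_add_left (weightedPerimeter_ball_le hn h c hr) _).trans ?_
  rw [← mul_add, ← lintegral_add_left hmeas]
  have : ∀ θ : Dir n, (h (sphereMap c r θ, θ) : ℝ≥0∞) + (1 - (h (sphereMap c r θ, θ) : ℝ≥0∞)) = 1 :=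
    fun θ => add_tsub_cancel_of_le (by exact_mod_cast h1 θ)
  simp only [this, lintegral_one]
  rw [toSphere_univ_eq, ← ENNReal.ofReal_mul (by positivity), mul_comm]

theorem setLIntegral_ball_eq_rayIntegral (hn : 1 ≤ n) {g : Space n → ℝ≥0∞} (hg : Measurable g)
    (r : Space n → ℝ) (c : Space n) :
    ∫⁻ x in ball c (r c), g x =
      ∫⁻ θ : Dir n, rayIntegral r g θ c ∂(volume : Measure (Space n)).toSphere := by
  have hm : Measurable fun x => (ball c (r c)).indicator g (c + x) :=
    (hg.indicator measurableSet_ball).comp (measurable_const_add c)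
  rw [← lintegral_indicator measurableSet_ball, ← lintegral_add_left_eq_self _ c,
    lintegral_eq_lintegral_sphere hn hm]
  refine lintegral_congr fun θ => ?_
  rw [rayIntegral]
  refine setLIntegral_congr_fun measurableSet_Ioi fun t ht => ?_
  have ht : 0 < t := ht
  have hmem : c + t • (θ : Space n) ∈ ball c (r c) ↔ t < r c := by
    rw [mem_ball, dist_eq_norm, add_sub_cancel_left, norm_smul, norm_dir, mul_one,
      Real.norm_of_nonneg ht.le]
  show ENNReal.ofReal (t ^ (n - 1)) * (ball c (r c)).indicator g (c + t • (θ : Space n)) = _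
  by_cases h : t < r c
  · rw [indicator_of_mem (hmem.2 h), if_pos h]
  · rw [indicator_of_notMem (mt hmem.1 h), if_neg h]

/-- The tangent to the `n`-th power at `r`, evaluated at `r₀`. It turns an excess of perimeter into
an excess of volume, and produces the factor `n - 1`. -/
theorem mul_pow_sub_pow_le (hn : 1 ≤ n) {r₀ r : ℝ} (hr₀ : 0 < r₀) (hr : 0 < r) :
    n * omega n * r ^ (n - 1) - n * omega n * r₀ ^ (n - 1) ≤
      (n - 1) / r₀ * (omega n * r ^ n - omega n * r₀ ^ n) := by
  have h1 := pow_add_mul_sub_le_pow n hr hr₀.le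
  have hω := omega_pos n
  have e : ∀ s : ℝ, s ^ n = s * s ^ (n - 1) := fun s => by
    rw [← pow_succ', Nat.sub_add_cancel hn]
  rw [div_mul_eq_mul_div, le_div_iff₀ hr₀]
  have h2 := mul_le_mul_of_nonneg_left h1 hω.le
  rw [e r, e r₀] at *
  linarith

/-- A ball whose perimeter is not below that of the Euclidean ball of the same volume gives a
bound of a spherical integral by an integral over the ball. -/
theorem lintegral_sphere_le_of_le_weightedPerimeter (hn : 1 ≤ n) {h : Space n × Dir n → ℝ≥0}
    (hh : Measurable h) {c : Space n} {r : Space n → ℝ} {r₀ : ℝ} (hr₀ : 0 < r₀) (hrc : r₀ ≤ r c)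
    (h1 : ∀ θ : Dir n, h (sphereMap c (r c) θ, θ) ≤ 1) {C : ℝ}
    {g : Space n → ℝ≥0∞} (hg : Measurable g)
    (hvol : ENNReal.ofReal (omega n * r c ^ n - omega n * r₀ ^ n) ≤
      ENNReal.ofReal C * ∫⁻ x in ball c (r c), g x)
    (hbad : ENNReal.ofReal (n * omega n * r₀ ^ (n - 1)) ≤ weightedPerimeter h (ball c (r c))) :
    ∫⁻ θ : Dir n, (1 - (h (sphereMap c (r c) θ, θ) : ℝ≥0∞))
        ∂(volume : Measure (Space n)).toSphere ≤
      ENNReal.ofReal ((n - 1) * C / r₀ ^ n) *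
        ∫⁻ θ : Dir n, rayIntegral r g θ c ∂(volume : Measure (Space n)).toSphere := by
  have hr : 0 < r c := hr₀.trans_le hrc
  have hω := omega_pos n
  have hn1 : (0 : ℝ) ≤ n - 1 := by
    have : (1 : ℝ) ≤ n := by exact_mod_cast hn
    linarith
  set X := ∫⁻ θ : Dir n, (1 - (h (sphereMap c (r c) θ, θ) : ℝ≥0∞))
        ∂(volume : Measure (Space n)).toSphere
  have key := (add_le_add_left hbad _).trans (weightedPerimeter_ball_add_le hn hh hr h1)
  have k1 : ENNReal.ofReal (r c ^ (n - 1)) * X ≤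
      ENNReal.ofReal (n * omega n * r c ^ (n - 1) - n * omega n * r₀ ^ (n - 1)) := by
    rw [ENNReal.ofReal_sub _ (by positivity)]
    exact ENNReal.le_sub_of_add_le_left ENNReal.ofReal_ne_top key
  have k2 : ENNReal.ofReal (r₀ ^ (n - 1)) * X ≤ ENNReal.ofReal ((n - 1) / r₀) *
      (ENNReal.ofReal C * ∫⁻ x in ball c (r c), g x) := by
    calc ENNReal.ofReal (r₀ ^ (n - 1)) * X ≤ ENNReal.ofReal (r c ^ (n - 1)) * X := by gcongr
      _ ≤ _ := k1
      _ ≤ ENNReal.ofReal ((n - 1) / r₀ * (omega n * r c ^ n - omega n * r₀ ^ n)) :=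
          ENNReal.ofReal_le_ofReal (mul_pow_sub_pow_le hn hr₀ hr)
      _ = ENNReal.ofReal ((n - 1) / r₀) * ENNReal.ofReal (omega n * r c ^ n - omega n * r₀ ^ n) :=
          ENNReal.ofReal_mul (by positivity)
      _ ≤ _ := by gcongr
  rw [← setLIntegral_ball_eq_rayIntegral hn hg]
  have k3 : X = ENNReal.ofReal ((r₀ ^ (n - 1))⁻¹) * (ENNReal.ofReal (r₀ ^ (n - 1)) * X) := by
    rw [← mul_assoc, ← ENNReal.ofReal_mul (by positivity), inv_mul_cancel₀ (by positivity),
      ENNReal.ofReal_one, one_mul]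
  rw [k3]
  refine (mul_le_mul_right k2 _).trans (le_of_eq ?_)
  rw [← mul_assoc, ← mul_assoc, ← ENNReal.ofReal_mul (by positivity),
    ← ENNReal.ofReal_mul (by positivity)]
  congr 2
  have e : r₀ ^ n = r₀ * r₀ ^ (n - 1) := by rw [← pow_succ', Nat.sub_add_cancel hn]
  rw [e]
  field_simp

/-- Every error factor is continuous in `s` and equals 1 at `s = 0`, so one small `s` serves for the
relative increase of the radius, for its Lipschitz constant and for the decay rate of the weight. -/
theorem exists_scale (n : ℕ) {r₀ A : ℝ} (hA : A < 1) :
    ∃ s : ℝ, 0 < s ∧ s ≤ 1 ∧ (1 + s) ^ n < 2 ∧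
      A * ((1 + s) ^ (n + 1) * (1 + s * (2 * (r₀ * (1 + s)))) ^ (n + 2) *
        ((1 + s) ^ n) ^ n) < 1 := by
  have h1 : ContinuousAt (fun s : ℝ => (1 + s) ^ n) 0 := by fun_prop
  have h2 : ContinuousAt (fun s : ℝ => A * ((1 + s) ^ (n + 1) *
      (1 + s * (2 * (r₀ * (1 + s)))) ^ (n + 2) * ((1 + s) ^ n) ^ n)) 0 := by fun_prop
  have e1 := (h1.eventually_lt_const (u := 2) (by simp)).filter_mono
    (nhdsWithin_le_nhds (s := Ioi 0))
  have e2 := (h2.eventually_lt_const (u := 1) (by simpa using hA)).filter_mono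
    (nhdsWithin_le_nhds (s := Ioi 0))
  have e0 : ∀ᶠ s in 𝓝[>] (0 : ℝ), s ∈ Ioc (0 : ℝ) 1 := Ioc_mem_nhdsGT zero_lt_one
  obtain ⟨s, hs, h3, h4⟩ := (e0.and (e1.and e2)).exists
  exact ⟨s, hs.1, hs.2, h3, h4⟩

theorem weightedVolume_ball_eq {f : Space n → ℝ≥0} {k : Space n → ℝ} {c : Space n} {r : ℝ}
    (hk : IntegrableOn k (ball c r)) (hkf : ∀ x ∈ ball c r, (f x : ℝ) = k x) :
    weightedVolume f (ball c r) = ENNReal.ofReal (∫ x in ball c r, k x) := by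
  rw [ofReal_integral_eq_lintegral_ofReal hk]
  · refine setLIntegral_congr_fun measurableSet_ball fun x hx => ?_
    rw [← hkf x hx, ENNReal.ofReal_coe_nnreal]
  · filter_upwards [ae_restrict_mem measurableSet_ball] with x hx
    rw [← hkf x hx]
    exact (f x).2

/-- Unless `h = 1` almost everywhere near infinity, some far ball has smaller weighted perimeter
than the Euclidean ball of the same volume. -/
theorem exists_ball_of_not_ae_eq_one (hn : 1 ≤ n) {f : Space n → ℝ≥0} {h : Space n × Dir n → ℝ≥0}
    (hfh : IsDoubleDensity f h) (hf : ConvergesFromBelow (fun x => (f x : ℝ≥0∞)) 1)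
    (hh : ConvergesFromBelow (hPlus h) 1) {C : ℝ} (hC0 : 0 ≤ C) (hC : (n - 1) * C / n < 1)
    (hfC : ∃ M : ℝ, ∀ x : Space n, M < ‖x‖ → fTilde f x ≤ C * hTilde h x)
    {r₀ : ℝ} (hr₀ : 0 < r₀) (R : ℝ)
    (hne : ¬ ∃ M : ℝ, ∀ᵐ p ∂(spaceDirMeasure n), M < ‖p.1‖ → h p = 1) :
    ∃ (c : Space n) (r : ℝ), 0 < r ∧ (∀ x ∈ ball c r, R < ‖x‖) ∧
      weightedVolume f (ball c r) = ENNReal.ofReal (omega n * r₀ ^ n) ∧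
      weightedPerimeter h (ball c r) < ENNReal.ofReal (n * omega n * r₀ ^ (n - 1)) := by
  obtain ⟨s, hs0, hs1, hs2, hs3⟩ := exists_scale n (r₀ := r₀) hC
  have hω := omega_pos n
  have hnpos : (0 : ℝ) < n := by exact_mod_cast hn
  have hn1 : (0 : ℝ) ≤ n - 1 := by
    have : (1 : ℝ) ≤ n := by exact_mod_cast hn
    linarith
  -- Chosen so that `(1 - η) r₁ⁿ = r₀ⁿ` for `r₁ = r₀ (1 + s)`; the Lipschitz constant of the radius
  -- is then `(1 + s) ^ n - 1`, below 1 by the choice of `s`.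
  set η : ℝ := 1 - ((1 + s) ^ n)⁻¹ with hη
  have hpow1 : 1 < (1 + s) ^ n := one_lt_pow₀ (by linarith) (by omega)
  have hη0 : 0 < η := sub_pos.2 (inv_lt_one_of_one_lt₀ hpow1)
  have hη1 : η < 1 := by
    have : 0 < ((1 + s) ^ n)⁻¹ := by positivity
    linarith
  set r₁ := r₀ * (1 + s) with hr₁
  have hr₀₁ : r₀ ≤ r₁ := by nlinarith
  have hηr : r₀ ^ n ≤ (1 - η) * r₁ ^ n := by
    rw [hη, sub_sub_cancel, hr₁, mul_pow]
    apply le_of_eq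
    field_simp
  have hδ : η / (1 - η) = (1 + s) ^ n - 1 := by
    rw [hη, sub_sub_cancel]; field_simp
  obtain ⟨hft, M₁, hM₁⟩ := hf
  obtain ⟨-, M₂, hM₂⟩ := hh
  obtain ⟨M₃, hM₃⟩ := hfC
  have hev : ∀ᶠ x in Bornology.cobounded (Space n), ENNReal.ofReal (1 - η) < (f x : ℝ≥0∞) :=
    hft.eventually_const_lt (by rw [ENNReal.ofReal_lt_one]; linarith)
  obtain ⟨M₄, -, hM₄⟩ := (hasBasis_cobounded_norm.eventually_iff).1 hev
  set R₀ := max R (max M₁ (max M₂ (max M₃ (max M₄ 0)))) with hR₀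
  have hR₀R : R ≤ R₀ := le_max_left _ _
  have hR₀0 : 0 ≤ R₀ := by simp [hR₀]
  have hfle : ∀ x : Space n, R₀ < ‖x‖ → f x ≤ 1 := fun x hx => by
    have h0 : (f x : ℝ≥0∞) ≤ 1 := hM₁ x (lt_of_le_of_lt (by simp [hR₀]) hx)
    exact_mod_cast h0
  have hple : ∀ x : Space n, R₀ < ‖x‖ → hPlus h x ≤ 1 := fun x hx =>
    hM₂ x (lt_of_le_of_lt (by simp [hR₀]) hx)
  have hfg : ∀ x : Space n, R₀ < ‖x‖ → fTilde f x ≤ C * hTilde h x := fun x hx =>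
    hM₃ x (lt_of_le_of_lt (by simp [hR₀]) hx)
  have hfgt : ∀ x : Space n, R₀ < ‖x‖ → 1 - η < f x := fun x hx => by
    have := hM₄ (show M₄ ≤ ‖x‖ from (show M₄ ≤ R₀ by simp [hR₀]).trans hx.le)
    rw [← ENNReal.ofReal_coe_nnreal] at this
    exact (ENNReal.ofReal_lt_ofReal_iff_of_nonneg (by linarith)).1 this
  have hhle : ∀ x : Space n, R₀ < ‖x‖ → ∀ θ, h (x, θ) ≤ 1 := fun x hx θ => by
    exact_mod_cast (le_iSup (fun ν : Dir n => (h (x, ν) : ℝ≥0∞)) θ).trans (hple x hx)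
  have hfm : Measurable f := hfh.lsc_f.measurable
  have hhm : Measurable h := hfh.lsc_h.measurable
  have hpm : Measurable (hPlus h) := measurable_hPlus hfh
  have hfar : MeasurableSet {x : Space n | R₀ < ‖x‖} :=
    measurableSet_lt measurable_const measurable_norm
  classical
  -- Replacing `f` by 1 near the origin makes the bounds global, so that radii exist for all
  -- centres; far balls do not see the change.
  set k : Space n → ℝ := fun x => if R₀ < ‖x‖ then (f x : ℝ) else 1 with hk
  have hkm : Measurable k := Measurable.ite hfar (by fun_prop) measurable_const
  have hkb : ∀ x, k x ∈ Icc (1 - η) 1 := by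
    intro x
    simp only [hk]
    split_ifs with hx
    · exact ⟨(hfgt x hx).le, by exact_mod_cast hfle x hx⟩
    · exact ⟨by linarith, le_rfl⟩
  obtain ⟨r, hrI, hrV, hrL⟩ := exists_radius hn hη0.le hη1 hkm hkb hr₀ hr₀₁ hηr
  have hr : IsRadiusField r₀ r₁ (Real.toNNReal (η / (1 - η))) r := by
    refine ⟨hr₀, hrI, hrL, ?_⟩
    rw [Real.toNNReal_lt_one, hδ]
    linarith
  set g : Space n → ℝ≥0∞ := fun x => if R₀ < ‖x‖ then 1 - hPlus h x else 0 with hg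
  have hgm : Measurable g := Measurable.ite hfar (by fun_prop) measurable_const
  set G : Space n × Dir n → ℝ≥0∞ := fun p => if R₀ < ‖p.1‖ then 1 - (h p : ℝ≥0∞) else 0 with hG
  have hGm : Measurable G :=
    Measurable.ite (measurable_fst hfar) (by fun_prop) measurable_const
  have hgG : ∀ x θ, g x ≤ G (x, θ) := by
    intro x θ
    simp only [hg, hG]
    split_ifs
    · exact tsub_le_tsub_left (le_iSup (fun ν : Dir n => (h (x, ν) : ℝ≥0∞)) θ) _
    · exact le_rfl
  have hG1 : ∀ p, G p ≤ 1 := by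
    intro p
    simp only [hG]
    split_ifs
    · exact tsub_le_self
    · exact zero_le
  have hball : ∀ c : Space n, R₀ + r₁ < ‖c‖ → ∀ x ∈ closedBall c (r c), R₀ < ‖x‖ := by
    intro c hc x hx
    rw [mem_closedBall, dist_comm, dist_eq_norm] at hx
    have := norm_sub_norm_le c x
    linarith [(hrI c).2]
  have hvol : ∀ c : Space n, R₀ + r₁ < ‖c‖ →
      weightedVolume f (ball c (r c)) = ENNReal.ofReal (omega n * r₀ ^ n) := by
    intro c hc
    rw [← hrV c]
    refine weightedVolume_ball_eq (integrableOn_ball_of_bounded hη1.le hkm hkb c _)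
      fun x hx => ?_
    simp only [hk]
    rw [if_pos (hball c hc x (ball_subset_closedBall hx))]
  -- From here on every far ball of the family is assumed to be no better than the Euclidean ball.
  by_contra! hbad
  have hbad' : ∀ c : Space n, R₀ + r₁ < ‖c‖ →
      ENNReal.ofReal (n * omega n * r₀ ^ (n - 1)) ≤ weightedPerimeter h (ball c (r c)) :=
    fun c hc => hbad c (r c) (hr₀.trans_le (hrI c).1)
      (fun x hx => hR₀R.trans_lt (hball c hc x (ball_subset_closedBall hx))) (hvol c hc)
  have hexcess : ∀ c : Space n, R₀ + r₁ < ‖c‖ →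
      ENNReal.ofReal (omega n * r c ^ n - omega n * r₀ ^ n) ≤
      ENNReal.ofReal C * ∫⁻ x in ball c (r c), g x := by
    intro c hc
    have hrc : 0 ≤ r c := hr₀.le.trans (hrI c).1
    have hki := integrableOn_ball_of_bounded hη1.le hkm hkb c (r c)
    have h1i : IntegrableOn (fun _ : Space n => (1 : ℝ)) (ball c (r c)) :=
      integrableOn_const measure_ball_lt_top.ne
    -- The ball has Euclidean volume `ω_n (r c)ⁿ` and weighted volume `ω_n r₀ⁿ`, so the difference
    -- is the integral of `1 - f`, to which the comparison with `1 - h⁺` applies.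
    have e : omega n * r c ^ n - omega n * r₀ ^ n = ∫ x in ball c (r c), (1 - k x) := by
      rw [integral_sub h1i hki, hrV c, setIntegral_const, smul_eq_mul, mul_one,
        measureReal_ball c hrc hn]
    have h2i : IntegrableOn (fun x => 1 - k x) (ball c (r c)) := h1i.sub hki
    rw [e, ofReal_integral_eq_lintegral_ofReal h2i
      (Eventually.of_forall fun x => sub_nonneg.2 (hkb x).2),
      ← lintegral_const_mul' _ _ ENNReal.ofReal_ne_top]
    refine setLIntegral_mono' measurableSet_ball fun x hx => ?_
    have hx := hball c hc x (ball_subset_closedBall hx)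
    simp only [hk, hg]
    rw [if_pos hx, if_pos hx]
    have h1 := hfg x hx
    have hpt : hPlus h x ≠ ⊤ := ((hple x hx).trans_lt ENNReal.one_lt_top).ne
    have hpr : (hPlus h x).toReal ≤ 1 := by
      simpa using ENNReal.toReal_mono ENNReal.one_ne_top (hple x hx)
    have hfx : (f x : ℝ) ≤ 1 := by exact_mod_cast hfle x hx
    rw [fTilde, hTilde, abs_sub_comm, abs_sub_comm _ (1 : ℝ), abs_of_nonneg (by linarith),
      abs_of_nonneg (by linarith)] at h1
    refine (ENNReal.ofReal_le_ofReal h1).trans (le_of_eq ?_)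
    rw [ENNReal.ofReal_mul hC0, ENNReal.ofReal_sub _ ENNReal.toReal_nonneg,
      ENNReal.ofReal_toReal hpt, ENNReal.ofReal_one]
  have hsph : ∀ c : Space n, R₀ + r₁ < ‖c‖ → ∀ θ : Dir n, R₀ < ‖spherePoint r θ c‖ := by
    intro c hc θ
    refine hball c hc _ ?_
    rw [mem_closedBall, dist_eq_norm, spherePoint, add_sub_cancel_left, norm_smul, norm_dir,
      mul_one, Real.norm_of_nonneg (hr₀.le.trans (hrI c).1)]
  have hfinal := hr.ae_eq_zero_of_forall_le hn hgm hGm hgG hG1 (R := R₀ + r₁) (ε := s)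
    (Λ := ENNReal.ofReal ((n - 1) * C / r₀ ^ n)) (by linarith) hs0 hs1 ?_ ?_
  · refine hne ⟨R₀ + r₁ + r₁, hfinal.mono fun p hp hpR => ?_⟩
    have hp0 : R₀ < ‖p.1‖ := by linarith
    have h1 := hp hpR
    simp only [hG] at h1
    rw [if_pos hp0, tsub_eq_zero_iff_le] at h1
    exact le_antisymm (hhle p.1 hp0 p.2) (by exact_mod_cast h1)
  -- The powers of `r₀` cancel, and the product is exactly the quantity made less than 1 by
  -- `exists_scale`.
  · have e1 : ((1 + Real.toNNReal (η / (1 - η)) : ℝ≥0) : ℝ≥0∞) = ENNReal.ofReal ((1 + s) ^ n) := by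
      rw [hδ, ENNReal.ofReal, ← Real.toNNReal_one, ← Real.toNNReal_add (by norm_num) (by linarith)]
      congr 2
      ring
    rw [e1, ← ENNReal.ofReal_pow (by positivity), ← ENNReal.ofReal_mul (by positivity),
      ← ENNReal.ofReal_mul (by positivity), ENNReal.ofReal_lt_one]
    refine lt_of_eq_of_lt ?_ hs3
    rw [hr₁]
    field_simp
    simp only [mul_pow]
    ring
  · intro c hc
    have hc' := hsph c hc
    have := lintegral_sphere_le_of_le_weightedPerimeter hn hhm hr₀ (hrI c).1
      (fun θ => hhle _ (hc' θ) θ) hgm (hexcess c hc) (hbad' c hc)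
    refine le_trans (le_of_eq ?_) this
    refine lintegral_congr fun θ => ?_
    simp only [hG]
    rw [if_pos (hc' θ)]
    rfl

/-- If `h = 1` almost everywhere near infinity, then also `f = 1` there, and any far ball is as
good as in the Euclidean case. -/
theorem exists_ball_of_ae_eq_one (hn : 1 ≤ n) {f : Space n → ℝ≥0} {h : Space n × Dir n → ℝ≥0}
    (hfh : IsDoubleDensity f h) (hh : ConvergesFromBelow (hPlus h) 1) {C : ℝ}
    (hfC : ∃ M : ℝ, ∀ x : Space n, M < ‖x‖ → fTilde f x ≤ C * hTilde h x)
    {r₀ : ℝ} (hr₀ : 0 < r₀) (R : ℝ)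
    (he : ∃ M : ℝ, ∀ᵐ p ∂(spaceDirMeasure n), M < ‖p.1‖ → h p = 1) :
    ∃ c : Space n, (∀ x ∈ ball c r₀, R < ‖x‖) ∧
      weightedVolume f (ball c r₀) = ENNReal.ofReal (omega n * r₀ ^ n) ∧
      weightedPerimeter h (ball c r₀) ≤ ENNReal.ofReal (n * omega n * r₀ ^ (n - 1)) := by
  have := nontrivial_space hn
  obtain ⟨-, M₂, hM₂⟩ := hh
  obtain ⟨M₃, hM₃⟩ := hfC
  obtain ⟨M₁, hM₁⟩ := he
  set R₀ := max R (max M₁ (max M₂ M₃)) with hR₀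
  obtain ⟨c, hc⟩ := NormedSpace.exists_lt_norm ℝ (Space n) (R₀ + r₀)
  have hball : ∀ x ∈ closedBall c r₀, R₀ < ‖x‖ := by
    intro x hx
    rw [mem_closedBall, dist_comm, dist_eq_norm] at hx
    have := norm_sub_norm_le c x
    linarith
  have hfar : ∀ x ∈ closedBall c r₀, R < ‖x‖ ∧ M₁ < ‖x‖ ∧ M₂ < ‖x‖ ∧ M₃ < ‖x‖ := by
    intro x hx
    have h0 := hball x hx
    refine ⟨lt_of_le_of_lt (by simp [hR₀]) h0, lt_of_le_of_lt (by simp [hR₀]) h0,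
      lt_of_le_of_lt (by simp [hR₀]) h0, lt_of_le_of_lt (by simp [hR₀]) h0⟩
  refine ⟨c, fun x hx => (hfar x (ball_subset_closedBall hx)).1, ?_, ?_⟩
  -- For almost every `x` in the ball some direction has `h = 1`. Then `h⁺ = 1` at `x`, and the
  -- comparison with `h̃ = 0` forces `f = 1`.
  · have hae : ∀ᵐ x : Space n, x ∈ ball c r₀ → (f x : ℝ≥0∞) = 1 := by
      filter_upwards [Measure.ae_ae_of_ae_prod hM₁] with x hx hxb
      have hx0 := hfar x (ball_subset_closedBall hxb)
      have hσ : (volume : Measure (Space n)).toSphere ≠ 0 := Measure.toSphere_ne_zero _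
      have : (ae (volume : Measure (Space n)).toSphere).NeBot := ae_neBot.2 hσ
      obtain ⟨θ, hθ⟩ := hx.exists
      have h1 : 1 ≤ hPlus h x := by
        refine le_trans ?_ (le_iSup (fun ν : Dir n => (h (x, ν) : ℝ≥0∞)) θ)
        rw [hθ hx0.2.1]; simp
      have h2 : hPlus h x = 1 := le_antisymm (hM₂ x hx0.2.2.1) h1
      have h3 := hM₃ x hx0.2.2.2
      rw [fTilde, hTilde, h2, ENNReal.toReal_one, sub_self, abs_zero, mul_zero] at h3
      have h4 : (f x : ℝ) = 1 := sub_eq_zero.1 (abs_nonpos_iff.1 h3)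
      exact_mod_cast h4
    rw [weightedVolume, setLIntegral_congr_fun_ae measurableSet_ball hae, setLIntegral_one,
      ← measureReal_ball c hr₀.le hn, measureReal_def, ENNReal.ofReal_toReal measure_ball_lt_top.ne]
  · refine le_trans le_self_add (weightedPerimeter_ball_add_le hn hfh.lsc_h.measurable hr₀
      fun θ => ?_)
    have hm : sphereMap c r₀ θ ∈ closedBall c r₀ := by
      rw [mem_closedBall, dist_eq_norm, sphereMap, add_sub_cancel_left, norm_smul, norm_dir,
        mul_one, Real.norm_of_nonneg hr₀.le]
    exact_mod_cast (le_iSup (fun ν : Dir n => (h (sphereMap c r₀ θ, ν) : ℝ≥0∞)) θ).trans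
      (hM₂ _ (hfar _ hm).2.2.1)

end DoubleDensity

theorem mainTheorem3 (n : ℕ) (hn : 2 ≤ n)
    (f : DoubleDensity.Space n → ℝ≥0)
    (h : DoubleDensity.Space n × DoubleDensity.Dir n → ℝ≥0)
    (hfh : DoubleDensity.IsDoubleDensity f h)
    (hf : DoubleDensity.ConvergesFromBelow (fun x => (f x : ℝ≥0∞)) 1)
    (hh : DoubleDensity.ConvergesFromBelow (DoubleDensity.hPlus h) 1)
    (hC : DoubleDensity.compareConst f h < (((n : ℝ) / ((n : ℝ) - 1) : ℝ) : EReal))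
    (m : ℝ) (hm : 0 < m) (R : ℝ) :
    (∃ (F : Set (DoubleDensity.Space n)) (ρ : ℝ≥0),
      (∀ x ∈ F, R < ‖x‖) ∧
      DoubleDensity.weightedVolume f F = ENNReal.ofReal m ∧
      DoubleDensity.IsMeanDensity f h F ρ ∧ ρ ≤ 1 ∧
      DoubleDensity.weightedPerimeter h F ≤
        ENNReal.ofReal
          (n * DoubleDensity.omega n ^ (1 / (n : ℝ)) * m ^ (((n : ℝ) - 1) / n))) ∧
    ((¬ ∃ M : ℝ, ∀ᵐ p ∂(DoubleDensity.spaceDirMeasure n), M < ‖p.1‖ → h p = 1) →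
      ∃ (F : Set (DoubleDensity.Space n)) (ρ : ℝ≥0),
        (∀ x ∈ F, R < ‖x‖) ∧
        DoubleDensity.weightedVolume f F = ENNReal.ofReal m ∧
        DoubleDensity.IsMeanDensity f h F ρ ∧ ρ < 1) := by
  have hn1 : 1 ≤ n := by omega
  have hω := DoubleDensity.omega_pos n
  have hn0 : (0 : ℝ) < n := by exact_mod_cast hn1
  have hn2 : (0 : ℝ) < n - 1 := by
    have : (2 : ℝ) ≤ n := by exact_mod_cast hn
    linarith
  -- An infimum strictly below the threshold provides an admissible `C` below it, whether or not the
  -- infimum is attained.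
  obtain ⟨C, hC0, hfC, hCn⟩ : ∃ C : ℝ, 0 ≤ C ∧
      (∃ M : ℝ, ∀ x : DoubleDensity.Space n, M < ‖x‖ →
        DoubleDensity.fTilde f x ≤ C * DoubleDensity.hTilde h x) ∧ (n - 1) * C / n < 1 := by
    rw [DoubleDensity.compareConst] at hC
    simp only [iInf_lt_iff] at hC
    obtain ⟨C, ⟨hC0, hfC⟩, hlt⟩ := hC
    refine ⟨C, hC0, hfC, ?_⟩
    have h1 : C < n / (n - 1) := by exact_mod_cast hlt
    rw [lt_div_iff₀ hn2] at h1
    rw [div_lt_one hn0]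
    linarith
  set r₀ : ℝ := (m / DoubleDensity.omega n) ^ (1 / (n : ℝ)) with hr₀
  have hr₀0 : 0 < r₀ := Real.rpow_pos_of_pos (div_pos hm hω) _
  have hmr : DoubleDensity.omega n * r₀ ^ n = m := by
    rw [hr₀, one_div, Real.rpow_inv_natCast_pow (div_pos hm hω).le (by omega),
      mul_div_cancel₀ _ hω.ne']
  have hconst := DoubleDensity.isoperimetric_const_eq hn1 hr₀0 hmr
  have hstrict : (¬ ∃ M : ℝ, ∀ᵐ p ∂(DoubleDensity.spaceDirMeasure n), M < ‖p.1‖ → h p = 1) →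
      ∃ (F : Set (DoubleDensity.Space n)) (ρ : ℝ≥0),
        (∀ x ∈ F, R < ‖x‖) ∧ DoubleDensity.weightedVolume f F = ENNReal.ofReal m ∧
        DoubleDensity.IsMeanDensity f h F ρ ∧ ρ < 1 ∧
        DoubleDensity.weightedPerimeter h F ≤ ENNReal.ofReal
          (n * DoubleDensity.omega n ^ (1 / (n : ℝ)) * m ^ (((n : ℝ) - 1) / n)) := by
    intro hne
    obtain ⟨c, r, hr, hfar, hvol, hper⟩ :=
      DoubleDensity.exists_ball_of_not_ae_eq_one hn1 hfh hf hh hC0 hCn hfC hr₀0 R hne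
    rw [hmr] at hvol
    rw [← hconst] at hper
    obtain ⟨ρ, hρ, -, hρ1⟩ := DoubleDensity.exists_isMeanDensity hn1 hm measurableSet_ball
      (DoubleDensity.hasFinitePerimeter_ball hn1 c hr) hvol hper.le
    exact ⟨_, ρ, hfar, hvol, hρ, hρ1 hper, hper.le⟩
  refine ⟨?_, fun hne => ?_⟩
  · by_cases he : ∃ M : ℝ, ∀ᵐ p ∂(DoubleDensity.spaceDirMeasure n), M < ‖p.1‖ → h p = 1
    · obtain ⟨c, hfar, hvol, hper⟩ :=
        DoubleDensity.exists_ball_of_ae_eq_one hn1 hfh hh hfC hr₀0 R he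
      rw [hmr] at hvol
      rw [← hconst] at hper
      obtain ⟨ρ, hρ, hρ1, -⟩ := DoubleDensity.exists_isMeanDensity hn1 hm measurableSet_ball
        (DoubleDensity.hasFinitePerimeter_ball hn1 c hr₀0) hvol hper
      exact ⟨_, ρ, hfar, hvol, hρ, hρ1, hper⟩
    · obtain ⟨F, ρ, h1, h2, h3, h4, h5⟩ := hstrict he
      exact ⟨F, ρ, h1, h2, h3, h4.le, h5⟩
  · obtain ⟨F, ρ, h1, h2, h3, h4, -⟩ := hstrict hne
    exact ⟨F, ρ, h1, h2, h3, h4⟩
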